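/- A *digit space* $(X,D)$ consists of a nonempty, bounded, complete metric space $(X,\mu)$ and a finite set $D$ of contractions $d:X\to X$ (i.e. $\mu(d(x),d(y))\le q\,\mu(x,y)$ for some $q<1$) with $\bigcup_{d\in D}d[X]=X$. Let $Q=\{u_0,u_1,\dots\}\subseteq X$ be dense. $(X,D,Q)$ is a *computable digit space* if the sets $\{(u,v,r)\in Q\times Q\times\mathbb Q : \mu(u,v)<r\}$ and $\{(u,v,r) : \mu(u,v)>r\}$ are computably enumerable (in terms of indices) and each $d\in D$ is computable, i.e. has a computable modulus of uniform continuity and there is an algorithm which, given $u\in Q$ and $n$, finds $v\in Q$ with $\mu(d(u),v)<2^{-n}$. It is * *well-covering* if every $x\in X$ lies in the interior of $d[X]$ for some $d\in D$; * *decidable* if for $u\in Q$, $\theta\in\mathbb Q_+$, $d\in D$ it is decidable whether $\{y : \mu(u,y)<\theta\}\subseteq d[X]$; * *uniformly invertible* if from $\theta\in\mathbb Q_+$ one can compute $\theta'\in\mathbb Q_+$ such that for all $d\in D$ and $x,y\in X$, $\mu(d(x),d(y))<\theta'$ implies $\mu(x,y)<\theta$; * *constructively dense* if there is an algorithm which,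 given $\theta\in\mathbb Q_+$, $d\in D$ and $u\in d[X]\cap Q$, finds $v\in Q$ with $\mu(u,d(v))<\theta$. Let $\mathrm K(X)$ be the set of nonempty compact subsets of $X$ and $\mu_{\mathrm H}$ the Hausdorff metric on it. Define * $\mathrm A=\{x\in X : \forall n\,\exists u\in Q\ \mu(x,u)<2^{-n}\}$; a realizer of $\mathrm A(x)$ is a sequence $(v_n)$ in $Q$ with $\mu(x,v_n)<2^{-n}$ for all $n$ (a *Cauchy name* of $x$). * $\mathrm C_0$, the largest subset of $X$ such that $x\in\mathrm C_0$ implies $x=d(y)$ for some $d\in D$, $y\in\mathrm C_0$. Coinductively, a realizer of $x\in\mathrm C_0$ is a stream $\alpha\in D^{\mathbb N}$ such that $x=\alpha_0(y)$ for some $y$ for which $(\alpha_{n+1})_n$ is a realizer of $y\in\mathrm C_0$. * $\mathrm A_{\mathrm K}$, the set of $A\in\mathrm K(X)$ such that for all $n$ there is a nonempty finite $U\subseteq Q$ with $\mu_{\mathrm H}(A,U)<2^{-n}$; a realizer of $\mathrm A_{\mathrm K}(A)$ is a sequence $(U_n)$ of such sets with $\mu_{\mathrm H}(A,U_n)<2^{-n}$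 for all $n$ (a *Hausdorff name* of $A$). * $\mathrm C_{\mathrm K}$, the largest subset of $\mathrm K(X)$ such that $A\in\mathrm C_{\mathrm K}$ implies $A=\bigcup_{d\in E}d[A_d]$ for some $E\subseteq D$ and $A_d\in\mathrm C_{\mathrm K}$ ($d\in E$). A *digital tree* is a prefix-closed set $T$ of finite sequences of digits that contains the empty sequence and in which every element has a one-digit extension in $T$; it is given by its characteristic function. Coinductively, a realizer of $A\in\mathrm C_{\mathrm K}$ is a digital tree $T$ such that $A=\bigcup_{[d]\in T}d[A_d]$ for some $A_d\in\mathrm K(X)$ for which $\{s : ds\in T\}$ is a realizer of $A_d\in\mathrm C_{\mathrm K}$. A stream $\alpha$ is a *digit name* of $x$ if $\bigcap_n(\alpha_0\circ\dots\circ\alpha_{n-1})[X]=\{x\}$, and a digital tree $T$ is a *tree name* of $A\in\mathrm K(X)$ if $A=\bigcap_n\bigcup\{(d_0\circ\dots\circ d_{n-1})[X] : [d_0,\dots,d_{n-1}]\in T\}$. Two notions of name (or of realizer) are *effectively equivalent* if there are oracle programs, one for each direction, that transform every name of the one kind of any object into a name of the other kind of the same object. **Corollary.** Let $(X,D,Q)$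 be a well-covering, decidable, uniformly invertible and constructively dense computable digit space. Then, read constructively: 1. $\mathrm A=\mathrm C_0$. That is, the two sets are equal, and realizers of $\mathrm A(x)$ and of $x\in\mathrm C_0$ are effectively equivalent; moreover Cauchy names and digit names of points are effectively equivalent. 2. $\mathrm A_{\mathrm K}=\mathrm C_{\mathrm K}$. That is, the two sets are equal, and realizers of $\mathrm A_{\mathrm K}(A)$ and of $A\in\mathrm C_{\mathrm K}$ are effectively equivalent; moreover Hausdorff names and tree names of nonempty compact sets are effectively equivalent. -/

import Mathlib

open TopologicalSpace Metric Set

/-! ### Computable functionals -/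

/-- Partial recursive functionals: partial functions `ℕ → ℕ` computed, uniformly in an oracle
`g : ℕ → ℕ`, by an oracle machine. This is `Nat.RecursiveIn` with one program for all oracles. -/
inductive RecursiveFunctional : ((ℕ → ℕ) → ℕ →. ℕ) → Prop
  | zero : RecursiveFunctional fun _ _ => Part.some 0
  | succ : RecursiveFunctional fun _ n => Part.some (n + 1)
  | left : RecursiveFunctional fun _ n => Part.some (Nat.unpair n).1
  | right : RecursiveFunctional fun _ n => Part.some (Nat.unpair n).2
  | oracle : RecursiveFunctional fun g n => Part.some (g n)
  | pair {f h : (ℕ → ℕ) → ℕ →. ℕ} (hf : RecursiveFunctional f) (hh : RecursiveFunctional h) :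
      RecursiveFunctional fun g n => (Nat.pair <$> f g n <*> h g n)
  | comp {f h : (ℕ → ℕ) → ℕ →. ℕ} (hf : RecursiveFunctional f) (hh : RecursiveFunctional h) :
      RecursiveFunctional fun g n => h g n >>= f g
  | prec {f h : (ℕ → ℕ) → ℕ →. ℕ} (hf : RecursiveFunctional f) (hh : RecursiveFunctional h) :
      RecursiveFunctional fun g p =>
        let (a, n) := Nat.unpair p
        n.rec (f g a) fun y IH => do
          let i ← IH
          h g (Nat.pair a (Nat.pair y i))
  | rfind {f : (ℕ → ℕ) → ℕ →. ℕ} (hf : RecursiveFunctional f) :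
      RecursiveFunctional fun g a =>
        Nat.rfind fun n => (fun m => m = 0) <$> f g (Nat.pair a n)

/-- A function between coded types as an oracle on natural numbers. -/
def asOracle {α β : Type*} [Primcodable α] [Primcodable β] (p : α → β) : ℕ → ℕ :=
  fun n => ((Encodable.decode n : Option α).map fun a => Encodable.encode (p a)).getD 0

/-- `R p x` is read "`p` is a name (realizer) of `x`". `EffectivelyReducible R S` says that some
oracle program transforms every `R`-name of every `x` into an `S`-name of the same `x`, that is,
the program realizes the statement "for all `x`, if `x` has an `R`-name then it has an
`S`-name". -/
def EffectivelyReducible {Y α β γ δ : Type*} [Primcodable α] [Primcodable β] [Primcodable γ]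
    [Primcodable δ] (R : (α → β) → Y → Prop) (S : (γ → δ) → Y → Prop) : Prop :=
  ∃ Φ : (ℕ → ℕ) → ℕ →. ℕ, RecursiveFunctional Φ ∧
    ∀ (p : α → β) (x : Y), R p x →
      ∃ q : γ → δ, S q x ∧ ∀ c : γ, Encodable.encode (q c) ∈ Φ (asOracle p) (Encodable.encode c)

/-- Computable translations in both directions. -/
def EffectivelyEquivalent {Y α β γ δ : Type*} [Primcodable α] [Primcodable β] [Primcodable γ]
    [Primcodable δ] (R : (α → β) → Y → Prop) (S : (γ → δ) → Y → Prop) : Prop :=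
  EffectivelyReducible R S ∧ EffectivelyReducible S R

/-! ### Codings of the rational numbers -/

/-- The rational number `(a - b) / (c + 1)` coded by `(a, b, c)`. -/
noncomputable def codedRat (t : ℕ × ℕ × ℕ) : ℝ := ((t.1 : ℝ) - t.2.1) / (t.2.2 + 1)

/-- The positive rational number `(a + 1) / (b + 1)` coded by `(a, b)`. -/
noncomputable def codedPosRat (t : ℕ × ℕ) : ℝ := ((t.1 : ℝ) + 1) / (t.2 + 1)

section DigitSpaces

variable {X : Type*} [MetricSpace X] {k : ℕ}

/-! ### Digit spaces -/

def IsContraction (d : X → X) : Prop :=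
  ∃ q : ℝ, q < 1 ∧ ∀ x y, dist (d x) (d y) ≤ q * dist x y

/-- The finite set of digits is given as `{D 0, …, D (k - 1)}`. -/
structure IsDigitSpace (D : Fin k → X → X) : Prop where
  nonempty : Nonempty X
  bounded : ∃ M : ℝ, ∀ x y : X, dist x y ≤ M
  complete : CompleteSpace X
  contraction : ∀ d, IsContraction (D d)
  cover : ⋃ d, range (D d) = univ

/-- The set of basic elements is `Q = {u 0, u 1, …}`; it is dense and the metric is computable
on it. -/
structure IsComputableMetricSpace (u : ℕ → X) : Prop where
  dense : DenseRange u
  lt_re : REPred fun t : ℕ × ℕ × (ℕ × ℕ × ℕ) => dist (u t.1) (u t.2.1) < codedRat t.2.2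
  gt_re : REPred fun t : ℕ × ℕ × (ℕ × ℕ × ℕ) => codedRat t.2.2 < dist (u t.1) (u t.2.1)

/-- A computable modulus of continuity, and a computable approximation on basic elements. -/
structure IsComputableMap (u : ℕ → X) (f : X → X) : Prop where
  modulus : ∃ m : ℕ → ℕ, Computable m ∧
    ∀ n x y, dist x y < (1 / 2 : ℝ) ^ m n → dist (f x) (f y) < (1 / 2 : ℝ) ^ n
  approx : ∃ g : ℕ → ℕ → ℕ, Computable₂ g ∧
    ∀ i n, dist (f (u i)) (u (g i n)) < (1 / 2 : ℝ) ^ n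

structure IsComputableDigitSpace (D : Fin k → X → X) (u : ℕ → X) : Prop where
  digitSpace : IsDigitSpace D
  metric : IsComputableMetricSpace u
  digit : ∀ d, IsComputableMap u (D d)

def WellCovering (D : Fin k → X → X) : Prop :=
  ∀ x, ∃ d, x ∈ interior (range (D d))

/-- It is decidable whether the ball of rational radius around a basic element is contained in
the image of a digit. -/
def DecidableDigitSpace (D : Fin k → X → X) (u : ℕ → X) : Prop :=
  ComputablePred fun t : ℕ × (ℕ × ℕ) × Fin k =>
    ball (u t.1) (codedPosRat t.2.1) ⊆ range (D t.2.2)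

/-- The procedure `φ` is only required to succeed on basic elements in the image of the digit. -/
def ConstructivelyDense (D : Fin k → X → X) (u : ℕ → X) : Prop :=
  ∃ φ : (ℕ × ℕ) × Fin k × ℕ →. ℕ, Partrec φ ∧
    ∀ (θ : ℕ × ℕ) (d : Fin k) (i : ℕ), u i ∈ range (D d) →
      ∃ j ∈ φ (θ, d, i), dist (u i) (D d (u j)) < codedPosRat θ

def UniformlyInvertible (D : Fin k → X → X) : Prop :=
  ∃ m : ℕ × ℕ → ℕ × ℕ, Computable m ∧
    ∀ (θ : ℕ × ℕ) (d : Fin k) (x y : X),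
      dist (D d x) (D d y) < codedPosRat (m θ) → dist x y < codedPosRat θ

/-! ### Points: Cauchy names and digit streams -/

/-- The predicate `A`. -/
def cauchySet (u : ℕ → X) : Set X :=
  {x | ∀ n : ℕ, ∃ v ∈ range u, dist x v < (1 / 2 : ℝ) ^ n}

/-- Realizers of `A x`: fast Cauchy sequences of (indices of) basic elements. -/
def CauchyName (u : ℕ → X) (p : ℕ → ℕ) (x : X) : Prop :=
  ∀ n, dist x (u (p n)) < (1 / 2 : ℝ) ^ n

/-- The coinductive predicate `C₀`, as the union of all sets that satisfy its defining
implication. -/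
def coindSet (D : Fin k → X → X) : Set X :=
  ⋃₀ {S | ∀ x ∈ S, ∃ d, ∃ y ∈ S, x = D d y}

/-- Realizers of `x ∈ C₀`, coinductively: the head of the stream is the digit `d`, its tail
realizes `y ∈ C₀`. -/
def CoindName (D : Fin k → X → X) (α : ℕ → Fin k) (x : X) : Prop :=
  ∃ R : (ℕ → Fin k) → X → Prop,
    (∀ β z, R β z → ∃ y, z = D (β 0) y ∧ R (fun n => β (n + 1)) y) ∧ R α x

/-- The composition `d₀ ∘ ⋯ ∘ dₙ₋₁` of a finite sequence of digits. -/
def applyDigits (D : Fin k → X → X) (s : List (Fin k)) (x : X) : X :=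
  s.foldr D x

/-- The digit representation: `x` is the point common to the images of all initial segments
of the stream. -/
def DigitName (D : Fin k → X → X) (α : ℕ → Fin k) (x : X) : Prop :=
  ⋂ n : ℕ, range (applyDigits D ((List.range n).map α)) = {x}

/-! ### Nonempty compact sets: Hausdorff names and digital trees -/

/-- The predicate `A_K`. -/
def cauchyCompacts (u : ℕ → X) : Set (NonemptyCompacts X) :=
  {A | ∀ n : ℕ, ∃ U : Set X, U.Finite ∧ U.Nonempty ∧ U ⊆ range u ∧
    hausdorffDist (A : Set X) U < (1 / 2 : ℝ) ^ n}

/-- Realizers of `A_K A`: fast Cauchy sequences of (lists of indices of) nonempty finite sets of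
basic elements, with respect to the Hausdorff metric. -/
def HausdorffName (u : ℕ → X) (p : ℕ → List ℕ) (A : NonemptyCompacts X) : Prop :=
  ∀ n, p n ≠ [] ∧ hausdorffDist (A : Set X) (u '' {i | i ∈ p n}) < (1 / 2 : ℝ) ^ n

/-- The coinductive predicate `C_K`, as the union of all sets that satisfy its defining
implication. -/
def coindCompacts (D : Fin k → X → X) : Set (NonemptyCompacts X) :=
  ⋃₀ {S | ∀ A ∈ S, ∃ (E : Set (Fin k)) (B : E → NonemptyCompacts X),
    (A : Set X) = ⋃ d : E, D d '' (B d : Set X) ∧ ∀ d : E, B d ∈ S}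

/-- Digital trees, given by a decision procedure: a set of finite sequences of digits that
contains the empty sequence, is closed under initial segments and has no maximal element. -/
structure IsDigitalTree (T : List (Fin k) → Bool) : Prop where
  nil : T [] = true
  prefix_closed : ∀ s d, T (s ++ [d]) = true → T s = true
  extend : ∀ s, T s = true → ∃ d, T (s ++ [d]) = true

/-- Realizers of `A ∈ C_K`, coinductively: the digits at the root of the tree form the set `E`,
and the immediate subtree at `d` realizes `B d ∈ C_K`. -/
def CoindTreeName (D : Fin k → X → X) (T : List (Fin k) → Bool) (A : NonemptyCompacts X) : Prop :=
  ∃ R : (List (Fin k) → Bool) → NonemptyCompacts X → Prop,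
    (∀ S K, R S K → IsDigitalTree S ∧
      ∃ B : {d : Fin k // S [d] = true} → NonemptyCompacts X,
        (K : Set X) = ⋃ d, D d.1 '' (B d : Set X) ∧
        ∀ d, R (fun s => S (d.1 :: s)) (B d)) ∧
    R T A

/-- The value of a digital tree. -/
def treeValue (D : Fin k → X → X) (T : List (Fin k) → Bool) : Set X :=
  ⋂ n : ℕ, ⋃ s ∈ {s : List (Fin k) | T s = true ∧ s.length = n}, range (applyDigits D s)

/-- The digital tree representation of nonempty compact sets. -/
def TreeName (D : Fin k → X → X) (T : List (Fin k) → Bool) (A : NonemptyCompacts X) : Prop :=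
  IsDigitalTree T ∧ treeValue D T = A

end DigitSpaces

/-! ### Computability of list operations -/

/-! The four predicates hold of everything, by density, covering and compactness; the content lies
in the translations of names. Uniform invertibility makes digits injective, so that coinductive
names are the same as digit names and tree names (`coindName_iff`, `digitName_iff`,
`coindTreeName_iff`), and two translations in each direction remain.

From digits to approximations, contraction does the work: all points in the image of a long word are
close together, so any computable approximation of one of them serves (`exists_word_evaluation`).

From approximations to digits, a Lebesgue number gives one radius at which every ball lies in the
image of a digit, and decidability finds that digit (`exists_digit_of_ball`). Uniform invertibility
and constructive density turn approximations of a point into approximations of its preimage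
(`exists_preimage_approximation`), and the process is iterated (`exists_digit_algorithm`). The
precisions needed are fixed in advance, so a program only asks a computable finite list of queries.
For a compact set the same algorithm is run along chains of mutually close basic elements taken from
the Hausdorff name; the resulting words form the tree (`hausdorffName_reducible_treeName`). -/

theorem Computable.list_foldl {α β σ : Type*} [Primcodable α] [Primcodable β] [Primcodable σ]
    {f : α → List β} {g : α → σ} {h : α → σ × β → σ} (hf : Computable f) (hg : Computable g)
    (hh : Computable₂ h) : Computable fun a => (f a).foldl (fun s b => h a (s, b)) (g a) := by
  have key : ∀ (l : List β) (s : σ) (h : σ × β → σ) (n : ℕ),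
      (l.take n).foldl (fun s b => h (s, b)) s =
        Nat.rec s (fun y ih => Option.casesOn (motive := fun _ => σ) l[y]? ih
          (fun b => h (ih, b))) n := by
    intro l s h n
    induction n with
    | zero => simp
    | succ n ih =>
      rw [List.take_add_one, List.foldl_append, ih]
      have hfold : ∀ (o : Option β) (t : σ), o.toList.foldl (fun s b => h (s, b)) t =
          Option.casesOn (motive := fun _ => σ) o t (fun b => h (t, b)) := by
        rintro (_ | _) t <;> rfl
      exact hfold _ _
  have step : Computable₂ fun (a : α) (p : ℕ × σ) =>
      Option.casesOn (motive := fun _ => σ) (f a)[p.1]? p.2 (fun b => h a (p.2, b)) := by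
    refine Computable.option_casesOn (o := fun q : α × ℕ × σ => (f q.1)[q.2.1]?)
      (f := fun q => q.2.2) (g := fun q b => h q.1 (q.2.2, b)) ?_ ?_ ?_
    · exact Computable.list_getElem?.comp (hf.comp .fst) (Computable.fst.comp .snd)
    · exact Computable.snd.comp .snd
    · exact (hh.comp (Computable.fst.comp .fst)
        (((Computable.snd.comp .snd).comp .fst).pair .snd)).to₂
  refine (Computable.nat_rec (Computable.list_length.comp hf) hg step).of_eq fun a => ?_
  have := key (f a) (g a) (h a) (f a).length
  rw [List.take_length] at this
  exact this.symm

theorem Computable.list_foldr {α β σ : Type*} [Primcodable α] [Primcodable β] [Primcodable σ]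
    {f : α → List β} {g : α → σ} {h : α → β × σ → σ} (hf : Computable f) (hg : Computable g)
    (hh : Computable₂ h) : Computable fun a => (f a).foldr (fun b s => h a (b, s)) (g a) := by
  have hh' : Computable₂ fun (a : α) (p : σ × β) => h a (p.2, p.1) :=
    (hh.comp .fst ((Computable.snd.comp .snd).pair (Computable.fst.comp .snd))).to₂
  refine (Computable.list_foldl (Computable.list_reverse.comp hf) hg hh').of_eq fun a => ?_
  rw [List.foldl_reverse]

theorem Computable.list_map {α β σ : Type*} [Primcodable α] [Primcodable β] [Primcodable σ]
    {f : α → List β} {g : α → β → σ} (hf : Computable f) (hg : Computable₂ g) :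
    Computable fun a => (f a).map (g a) := by
  have hh : Computable₂ fun (a : α) (p : β × List σ) => g a p.1 :: p.2 :=
    (Computable.list_cons.comp (hg.comp .fst (Computable.fst.comp .snd))
      (Computable.snd.comp .snd)).to₂
  refine (Computable.list_foldr hf (Computable.const []) hh).of_eq fun a => ?_
  induction f a with
  | nil => rfl
  | cons b l ih => simp [ih]

theorem Computable.list_flatMap {α β σ : Type*} [Primcodable α] [Primcodable β] [Primcodable σ]
    {f : α → List β} {g : α → β → List σ} (hf : Computable f) (hg : Computable₂ g) :
    Computable fun a => (f a).flatMap (g a) := by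
  refine (Primrec.list_flatten.to_comp.comp (Computable.list_map hf hg)).of_eq fun a => ?_
  rw [List.flatMap_def]

theorem Computable.list_all {α β : Type*} [Primcodable α] [Primcodable β]
    {f : α → List β} {g : α → β → Bool} (hf : Computable f) (hg : Computable₂ g) :
    Computable fun a => (f a).all (g a) := by
  have hh : Computable₂ fun (a : α) (p : β × Bool) => g a p.1 && p.2 :=
    (Primrec.and.to_comp.comp (hg.comp .fst (Computable.fst.comp .snd))
      (Computable.snd.comp .snd)).to₂
  refine (Computable.list_foldr hf (Computable.const true) hh).of_eq fun a => ?_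
  induction f a with
  | nil => rfl
  | cons b l ih => simp [ih]

theorem Computable.list_any {α β : Type*} [Primcodable α] [Primcodable β]
    {f : α → List β} {g : α → β → Bool} (hf : Computable f) (hg : Computable₂ g) :
    Computable fun a => (f a).any (g a) := by
  have hh : Computable₂ fun (a : α) (p : β × Bool) => g a p.1 || p.2 :=
    (Primrec.or.to_comp.comp (hg.comp .fst (Computable.fst.comp .snd))
      (Computable.snd.comp .snd)).to₂
  refine (Computable.list_foldr hf (Computable.const false) hh).of_eq fun a => ?_
  induction f a with
  | nil => rfl
  | cons b l ih => simp [ih]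

theorem Computable.list_sections {α : Type*} [Primcodable α] :
    Computable (List.sections : List (List α) → List (List α)) := by
  have hh : Computable₂ fun (_ : List (List α)) (p : List α × List (List α)) =>
      p.2.flatMap fun s => p.1.map fun b => b :: s := by
    have hg : Computable₂ fun (q : List (List α) × List α × List (List α)) (s : List α) =>
        q.2.1.map fun b => b :: s :=
      Computable.list_map (f := fun r : (List (List α) × List α × List (List α)) × List α =>
        r.1.2.1) (g := fun r b => b :: r.2) ((Computable.fst.comp .snd).comp .fst)
        (Computable.list_cons.comp .snd (Computable.snd.comp .fst)).to₂
    exact (Computable.list_flatMap (Computable.snd.comp .snd) hg).to₂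
  refine (Computable.list_foldr Computable.id (Computable.const [[]]) hh).of_eq fun L => ?_
  induction L with
  | nil => rfl
  | cons l L ih => simpa [List.sections] using congrArg _ ih

theorem Computable.two_pow : Computable fun n : ℕ => 2 ^ n := by
  have hh : Computable₂ fun (_ : ℕ) (p : ℕ × ℕ) => p.2 * 2 :=
    (Primrec.nat_mul.to_comp.comp (Computable.snd.comp .snd) (Computable.const 2)).to₂
  refine (Computable.nat_rec Computable.id (Computable.const 1) hh).of_eq fun n => ?_
  induction n with
  | zero => rfl
  | succ n ih => simpa [pow_succ] using ih

/-- A finite family of computable functions is uniformly computable. -/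
theorem Computable.of_finite_family {ι α σ : Type*} [Primcodable ι] [Finite ι] [Primcodable α]
    [Primcodable σ] {f : ι → α → σ} (hf : ∀ i, Computable (f i)) : Computable₂ f := by
  have H : ∀ i, ∃ c : Nat.Partrec.Code, ∀ a,
      Encodable.encode (f i a) ∈ c.eval (Encodable.encode a) := by
    -- Codes may be chosen without uniformity: a finite table of them is computable, and a universal
    -- machine runs the one looked up.
    intro i
    obtain ⟨c, hc⟩ := Nat.Partrec.Code.exists_code.1 (hf i)
    exact ⟨c, fun a => by simp [hc]⟩
  choose c hc using H
  have h : Partrec fun p : ι × α => (c p.1).eval (Encodable.encode p.2) :=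
    Nat.Partrec.Code.eval_part.comp ((Primrec.dom_finite c).to_comp.comp .fst)
      (Computable.encode.comp .snd)
  exact Computable.encode_iff.1 (h.of_eq_tot fun p => hc p.1 p.2)

/-! ### Oracle programs with a bounded list of queries -/

namespace RecursiveFunctional

theorem of_partrec {f : ℕ →. ℕ} (hf : Nat.Partrec f) : RecursiveFunctional fun _ => f := by
  induction hf with
  | zero => exact zero
  | succ => exact succ
  | left => exact left
  | right => exact right
  | pair _ _ h₁ h₂ => exact pair h₁ h₂
  | comp _ _ h₁ h₂ => exact comp h₁ h₂
  | prec _ _ h₁ h₂ => exact prec h₁ h₂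
  | rfind _ h => exact rfind h

theorem of_computable {f : ℕ → ℕ} (hf : Computable f) :
    RecursiveFunctional fun _ n => Part.some (f n) :=
  of_partrec (Partrec.nat_iff.1 hf)

theorem comp_some {f h : (ℕ → ℕ) → ℕ → ℕ} (hf : RecursiveFunctional fun g n => Part.some (f g n))
    (hh : RecursiveFunctional fun g n => Part.some (h g n)) :
    RecursiveFunctional fun g n => Part.some (f g (h g n)) := by
  have := comp hf hh
  simpa using this

theorem pair_some {f h : (ℕ → ℕ) → ℕ → ℕ} (hf : RecursiveFunctional fun g n => Part.some (f g n))
    (hh : RecursiveFunctional fun g n => Part.some (h g n)) :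
    RecursiveFunctional fun g n => Part.some (Nat.pair (f g n) (h g n)) := by
  have := pair hf hh
  simpa [Seq.seq] using this

theorem prec_some {f : (ℕ → ℕ) → ℕ → ℕ} {h : (ℕ → ℕ) → ℕ → ℕ}
    (hf : RecursiveFunctional fun g n => Part.some (f g n))
    (hh : RecursiveFunctional fun g n => Part.some (h g n)) :
    RecursiveFunctional fun g p => Part.some
      (Nat.rec (f g p.unpair.1) (fun y i => h g (Nat.pair p.unpair.1 (Nat.pair y i)))
        p.unpair.2 : ℕ) := by
  have := prec hf hh
  refine cast (congrArg _ ?_) this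
  funext g p
  dsimp only
  induction p.unpair.2 with
  | zero => rfl
  | succ n ih =>
    simp only [] at ih ⊢
    rw [ih]
    exact Part.bind_some _ _

/-- Primitive recursion along the query list collects the answers. The code of `[]` is `0` and that
of `b :: l` is `Nat.succ (Nat.pair b l)` on codes, so the answers pile up in reverse order and are
reversed at the end. -/
theorem bounded_queries {Q : ℕ → List ℕ} {F : ℕ → List (ℕ × ℕ) → ℕ} (hQ : Computable Q)
    (hF : Computable₂ F) :
    RecursiveFunctional fun g n => Part.some (F n ((Q n).map fun a => (a, g a))) := by
  let query : ℕ → ℕ := fun p => (Q p.unpair.1)[p.unpair.2.unpair.1]?.getD 0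
  have hquery : Computable query := by
    refine Computable.option_getD (Computable.list_getElem?.comp
      (hQ.comp (Computable.fst.comp Computable.unpair)) ?_) (Computable.const 0)
    exact Computable.fst.comp (Computable.unpair.comp (Computable.snd.comp Computable.unpair))
  have hstate : Computable fun p : ℕ => p.unpair.2.unpair.2 :=
    Computable.snd.comp (Computable.unpair.comp (Computable.snd.comp Computable.unpair))
  have hstep : RecursiveFunctional fun g p => Part.some
      (Nat.succ (Nat.pair (Nat.pair (query p) (g (query p))) p.unpair.2.unpair.2)) :=
    comp_some (f := fun _ n => Nat.succ n) succ (pair_some (pair_some (of_computable hquery)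
      (comp_some (f := fun g n => g n) oracle (of_computable hquery))) (of_computable hstate))
  have hrec := prec_some (of_computable (Computable.const 0)) hstep
  have hlen : Computable fun n => Nat.pair n (Q n).length :=
    Primrec₂.natPair.to_comp.comp Computable.id (Computable.list_length.comp hQ)
  have hfinal : Computable fun p : ℕ => F p.unpair.1
      ((Encodable.decode p.unpair.2 : Option (List (ℕ × ℕ))).getD []).reverse :=
    hF.comp (Computable.fst.comp Computable.unpair) (Computable.list_reverse.comp
      (Computable.option_getD (Computable.decode.comp (Computable.snd.comp Computable.unpair))
        (Computable.const [])))
  have h := comp_some (of_computable hfinal) (pair_some (of_computable Computable.id)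
    (comp_some hrec (of_computable hlen)))
  refine cast (congrArg _ ?_) h
  funext g n
  have key : ∀ m ≤ (Q n).length,
      (Nat.rec 0 (fun y i => Nat.succ (Nat.pair (Nat.pair (query (Nat.pair n (Nat.pair y i)))
        (g (query (Nat.pair n (Nat.pair y i))))) i)) m : ℕ) =
      Encodable.encode (((Q n).take m).map fun a => (a, g a)).reverse := by
    intro m
    induction m with
    | zero => intro _; simp
    | succ m ih =>
      intro hm
      dsimp only
      rw [ih (by omega), List.take_add_one, List.getElem?_eq_getElem (by omega)]
      simp only [query, Nat.unpair_pair, List.getElem?_eq_getElem (show m < (Q n).length by omega),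
        Option.getD_some, List.map_append, List.reverse_append, Option.toList_some, List.map_cons,
        List.map_nil, List.reverse_singleton, List.singleton_append, Encodable.encode_list_cons]
      simp
  have key' := key _ le_rfl
  rw [List.take_length] at key'
  simp only [Nat.unpair_pair] at key' ⊢
  rw [key']
  simp

end RecursiveFunctional

theorem asOracle_encode {α β : Type*} [Primcodable α] [Primcodable β] (p : α → β) (a : α) :
    asOracle p (Encodable.encode a) = Encodable.encode (p a) := by
  simp [asOracle]

/-- A translation that computes each value of the new name from the values of the given name at
a computable list of arguments is effective. -/
theorem EffectivelyReducible.of_computable {Y α β γ δ : Type*} [Primcodable α] [Primcodable β]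
    [Primcodable γ] [Primcodable δ] {R : (α → β) → Y → Prop} {S : (γ → δ) → Y → Prop}
    {Q : γ → List α} {F : γ → List (α × β) → δ} (hQ : Computable Q) (hF : Computable₂ F)
    (h : ∀ p x, R p x → S (fun c => F c ((Q c).map fun a => (a, p a))) x) :
    EffectivelyReducible R S := by
  let Q' : ℕ → List ℕ := fun n =>
    ((Encodable.decode n : Option γ).map fun c => (Q c).map Encodable.encode).getD []
  -- A list of pairs of codes has the same code as the list of coded pairs, so encoding and decoding
  -- again recovers the typed answers.
  let F' : ℕ → List (ℕ × ℕ) → ℕ := fun n v =>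
    ((Encodable.decode n : Option γ).bind fun c =>
      (Encodable.decode (Encodable.encode v) : Option (List (α × β))).map fun l =>
        Encodable.encode (F c l)).getD 0
  have hQ' : Computable Q' := by
    have hg : Computable₂ fun (_ : ℕ) (c : γ) => (Q c).map Encodable.encode :=
      Computable.list_map (f := fun q : ℕ × γ => Q q.2) (g := fun _ a => Encodable.encode a)
        (hQ.comp .snd) (Computable.encode.comp .snd).to₂
    exact Computable.option_getD (Computable.option_map Computable.decode hg) (Computable.const [])
  have hF' : Computable₂ F' := by
    have hg : Computable₂ fun (q : ℕ × List (ℕ × ℕ)) (c : γ) =>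
        (Encodable.decode (Encodable.encode q.2) : Option (List (α × β))).map fun l =>
          Encodable.encode (F c l) :=
      Computable.option_map (f := fun r : (ℕ × List (ℕ × ℕ)) × γ =>
          (Encodable.decode (Encodable.encode r.1.2) : Option (List (α × β))))
        (g := fun r l => Encodable.encode (F r.2 l))
        (Computable.decode.comp (Computable.encode.comp (Computable.snd.comp .fst)))
        (Computable.encode.comp (hF.comp (Computable.snd.comp .fst) .snd)).to₂
    exact Computable.option_getD (Computable.option_bind (Computable.decode.comp .fst) hg)
      (Computable.const 0)
  refine ⟨_, RecursiveFunctional.bounded_queries hQ' hF', fun p x hp => ⟨_, h p x hp, fun c => ?_⟩⟩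
  have hmap : ((Q c).map Encodable.encode).map (fun a => (a, asOracle p a)) =
      ((Q c).map fun a => (Encodable.encode a, Encodable.encode (p a))) := by
    simp [asOracle_encode]
  have hdec : (Encodable.decode (Encodable.encode ((Q c).map fun a =>
      (Encodable.encode a, Encodable.encode (p a)))) : Option (List (α × β))) =
      some ((Q c).map fun a => (a, p a)) := by
    have : Encodable.encode ((Q c).map fun a => (Encodable.encode a, Encodable.encode (p a))) =
        Encodable.encode ((Q c).map fun a => (a, p a)) := by
      induction Q c with
      | nil => rfl
      | cons a l ih => simp [ih]
    rw [this, Encodable.encodek]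
  rw [Part.mem_some_iff]
  simp only [Q', F', Encodable.encodek, Option.map_some, Option.getD_some, hmap, Option.bind_some,
    hdec]

section DigitSpaceGeometry

variable {X : Type*} [MetricSpace X] {k : ℕ} {D : Fin k → X → X}

/-! ### Compositions of digits -/

theorem applyDigits_append {X : Type*} {D : Fin k → X → X} (s t : List (Fin k))
    (x : X) : applyDigits D (s ++ t) x = applyDigits D s (applyDigits D t x) :=
  List.foldr_append

theorem range_applyDigits_append_subset {X : Type*} {D : Fin k → X → X}
    (s t : List (Fin k)) :
    range (applyDigits D (s ++ t)) ⊆ range (applyDigits D s) := by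
  rintro _ ⟨x, rfl⟩
  exact ⟨_, (applyDigits_append s t x).symm⟩

namespace IsDigitSpace

theorem exists_ratio (h : IsDigitSpace D) :
    ∃ q : ℝ, 0 ≤ q ∧ q < 1 ∧ ∀ d x y, dist (D d x) (D d y) ≤ q * dist x y := by
  choose q hq hD using h.contraction
  obtain ⟨x⟩ := h.nonempty
  have hx : x ∈ ⋃ d, range (D d) := h.cover ▸ mem_univ x
  obtain ⟨d, -⟩ := mem_iUnion.1 hx
  have : Nonempty (Fin k) := ⟨d⟩
  obtain ⟨d₀, hd₀⟩ := Finite.exists_max q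
  -- A contraction ratio is allowed to be negative.
  refine ⟨max (q d₀) 0, le_max_right _ _, max_lt (hq d₀) one_pos, fun d x y => ?_⟩
  exact (hD d x y).trans
    (mul_le_mul_of_nonneg_right ((hd₀ d).trans (le_max_left _ _)) dist_nonneg)

theorem dist_le (h : IsDigitSpace D) (d : Fin k) (x y : X) :
    dist (D d x) (D d y) ≤ dist x y := by
  obtain ⟨q, -, hq1, hq⟩ := h.exists_ratio
  nlinarith [hq d x y, dist_nonneg (x := x) (y := y)]

theorem continuous_applyDigits (h : IsDigitSpace D) (s : List (Fin k)) :
    Continuous (applyDigits D s) := by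
  have hd : ∀ d, Continuous (D d) := fun d =>
    (LipschitzWith.of_dist_le_mul (K := 1) fun x y => by simpa using h.dist_le d x y).continuous
  induction s with
  | nil => exact continuous_id
  | cons d s ih => exact (hd d).comp ih

/-- The diameter of the image of a word is exponentially small in the length of the word. -/
theorem exists_level (h : IsDigitSpace D) :
    ∃ lev : ℕ → ℕ, Computable lev ∧ ∀ m (s : List (Fin k)), s.length = lev m →
      ∀ x y, dist (applyDigits D s x) (applyDigits D s y) < (1 / 2 : ℝ) ^ m := by
  obtain ⟨q, hq0, hq1, hq⟩ := h.exists_ratio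
  obtain ⟨M, hM⟩ := h.bounded
  have hdist : ∀ (s : List (Fin k)) x y,
      dist (applyDigits D s x) (applyDigits D s y) ≤ q ^ s.length * dist x y := by
    intro s x y
    induction s with
    | nil => simp [applyDigits]
    | cons d s ih =>
      refine (hq d _ _).trans ?_
      rw [List.length_cons, pow_succ', mul_assoc]
      exact mul_le_mul_of_nonneg_left ih hq0
  -- Any `c` digits at least halve distances, and `2 ^ c'` exceeds the bound `M`. Both are fixed
  -- numbers, so the level `c * (m + c')` is computable although `q` and `M` need not be.
  obtain ⟨c, hc⟩ := exists_pow_lt_of_lt_one (show (0 : ℝ) < 1 / 2 by norm_num) hq1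
  obtain ⟨c', hc'⟩ := pow_unbounded_of_one_lt M (show (1 : ℝ) < 2 by norm_num)
  refine ⟨fun m => c * (m + c'), ?_, fun m s hs x y => ?_⟩
  · exact Primrec.nat_mul.to_comp.comp (Computable.const c)
      (Primrec.nat_add.to_comp.comp Computable.id (Computable.const c'))
  · have h1 : q ^ s.length ≤ (1 / 2 : ℝ) ^ (m + c') := by
      rw [hs, pow_mul]
      exact pow_le_pow_left₀ (pow_nonneg hq0 _) hc.le _
    calc dist (applyDigits D s x) (applyDigits D s y) ≤ q ^ s.length * dist x y := hdist s x y
      _ ≤ (1 / 2 : ℝ) ^ (m + c') * dist x y := mul_le_mul_of_nonneg_right h1 dist_nonneg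
      _ < (1 / 2 : ℝ) ^ (m + c') * 2 ^ c' :=
        mul_lt_mul_of_pos_left ((hM x y).trans_lt hc') (by positivity)
      _ = (1 / 2 : ℝ) ^ m := by
        rw [pow_add, mul_assoc, ← mul_pow]; norm_num

theorem exists_word (h : IsDigitSpace D) (n : ℕ) (x : X) :
    ∃ s : List (Fin k), s.length = n ∧ x ∈ range (applyDigits D s) := by
  induction n generalizing x with
  | zero => exact ⟨[], rfl, x, rfl⟩
  | succ n ih =>
    have hx : x ∈ ⋃ d, range (D d) := h.cover ▸ mem_univ x
    obtain ⟨d, y, rfl⟩ := mem_iUnion.1 hx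
    obtain ⟨s, rfl, z, rfl⟩ := ih y
    exact ⟨d :: s, rfl, z, rfl⟩

/-- The images of the finitely many words of one length cover the space and are small, which gives
total boundedness. -/
theorem compactSpace (h : IsDigitSpace D) : CompactSpace X := by
  have := h.complete
  obtain ⟨x₀⟩ := h.nonempty
  obtain ⟨lev, -, hlev⟩ := h.exists_level
  refine ⟨isCompact_iff_totallyBounded_isComplete.2 ⟨Metric.totallyBounded_iff.2 fun ε hε => ?_,
    isComplete_univ⟩⟩
  obtain ⟨m, hm⟩ := exists_pow_lt_of_lt_one hε (show (1 / 2 : ℝ) < 1 by norm_num)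
  refine ⟨(fun s => applyDigits D s x₀) '' {s | s.length = lev m},
    (List.finite_length_eq _ _).image _, fun x _ => ?_⟩
  obtain ⟨s, hs, y, rfl⟩ := h.exists_word (lev m) x
  simp only [biUnion_image, mem_iUnion, mem_ball]
  exact ⟨s, hs, (hlev m s hs _ _).trans hm⟩

theorem isClosed_range (h : IsDigitSpace D) (s : List (Fin k)) :
    IsClosed (range (applyDigits D s)) := by
  have := h.compactSpace
  exact (isCompact_range (h.continuous_applyDigits s)).isClosed

end IsDigitSpace

theorem UniformlyInvertible.injective (h : UniformlyInvertible D) (d : Fin k) :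
    Function.Injective (D d) := by
  obtain ⟨m, -, hm⟩ := h
  intro x y hxy
  refine eq_of_forall_dist_le fun ε hε => ?_
  obtain ⟨n, hn⟩ := exists_nat_one_div_lt hε
  refine ((hm (0, n) d x y ?_).trans ?_).le
  · rw [hxy, dist_self]
    unfold codedPosRat
    positivity
  · simpa [codedPosRat] using hn

/-! ### Digit names -/

/-- The right-hand side serves as the coinduction witness. Injectivity ensures that one preimage
under the first digit works for all lengths at once. -/
theorem coindName_iff {X : Type*} {D : Fin k → X → X} (hinj : ∀ d, Function.Injective (D d))
    {α : ℕ → Fin k} {x : X} :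
    CoindName D α x ↔ ∀ n, x ∈ range (applyDigits D ((List.range n).map α)) := by
  have hrange : ∀ (n : ℕ) (β : ℕ → Fin k),
      (List.range (n + 1)).map β = β 0 :: (List.range n).map fun n => β (n + 1) := by
    intro n β
    simp [List.range_succ_eq_map, Function.comp_def]
  constructor
  · rintro ⟨R, hR, hx⟩ n
    induction n generalizing α x with
    | zero => exact ⟨x, rfl⟩
    | succ n ih =>
      obtain ⟨y, rfl, hy⟩ := hR _ _ hx
      obtain ⟨z, hz⟩ := ih hy
      rw [hrange]
      exact ⟨z, congrArg (D (α 0)) hz⟩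
  · intro hx
    refine ⟨fun α x => ∀ n, x ∈ range (applyDigits D ((List.range n).map α)), ?_, hx⟩
    intro β z hz
    obtain ⟨y, rfl⟩ := hz 1
    refine ⟨y, rfl, fun n => ?_⟩
    obtain ⟨w, hw⟩ := hz (n + 1)
    rw [hrange] at hw
    exact ⟨w, hinj _ hw⟩

/-- Uniqueness is automatic, since the diameters of the images tend to zero. -/
theorem digitName_iff (h : IsDigitSpace D) {α : ℕ → Fin k} {x : X} :
    DigitName D α x ↔ ∀ n, x ∈ range (applyDigits D ((List.range n).map α)) := by
  unfold DigitName
  constructor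
  · intro hx
    exact mem_iInter.1 (hx ▸ mem_singleton x)
  · intro hx
    refine Subset.antisymm (fun y hy => ?_) (singleton_subset_iff.2 (mem_iInter.2 hx))
    obtain ⟨lev, -, hlev⟩ := h.exists_level
    refine eq_of_forall_dist_le fun ε hε => ?_
    obtain ⟨m, hm⟩ := exists_pow_lt_of_lt_one hε (show (1 / 2 : ℝ) < 1 by norm_num)
    obtain ⟨a, rfl⟩ := mem_iInter.1 hy (lev m)
    obtain ⟨b, hb⟩ := hx (lev m)
    rw [← hb]
    exact ((hlev m _ (by simp) a b).trans hm).le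

/-! ### Digital trees -/

theorem mem_treeValue {X : Type*} {D : Fin k → X → X} {T : List (Fin k) → Bool} {x : X} :
    x ∈ treeValue D T ↔
      ∀ n, ∃ s, (T s = true ∧ s.length = n) ∧ x ∈ range (applyDigits D s) := by
  simp [treeValue]

namespace IsDigitalTree

variable {T : List (Fin k) → Bool}

theorem of_append (hT : IsDigitalTree T) {s t : List (Fin k)} (h : T (s ++ t) = true) :
    T s = true := by
  induction t using List.reverseRecOn with
  | nil => simpa using h
  | append_singleton t d ih => exact ih (hT.prefix_closed _ d (by simpa using h))

theorem subtree (hT : IsDigitalTree T) {d : Fin k} (hd : T [d] = true) :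
    IsDigitalTree fun s => T (d :: s) :=
  ⟨hd, fun s e => hT.prefix_closed (d :: s) e, fun s => hT.extend (d :: s)⟩

theorem exists_length (hT : IsDigitalTree T) (n : ℕ) : ∃ s, T s = true ∧ s.length = n := by
  induction n with
  | zero => exact ⟨[], hT.nil, rfl⟩
  | succ n ih =>
    obtain ⟨s, hs, rfl⟩ := ih
    obtain ⟨d, hd⟩ := hT.extend s hs
    exact ⟨s ++ [d], hd, by simp⟩

end IsDigitalTree

theorem isClosed_treeValue (h : IsDigitSpace D) (T : List (Fin k) → Bool) :
    IsClosed (treeValue D T) := by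
  refine isClosed_iInter fun n => Finite.isClosed_biUnion ?_ fun s _ => h.isClosed_range s
  exact (List.finite_length_eq _ n).subset fun s hs => hs.2

/-- Cantor's intersection theorem: the levels of the tree give a decreasing sequence of nonempty
compact sets. -/
theorem nonempty_treeValue (h : IsDigitSpace D) {T : List (Fin k) → Bool} (hT : IsDigitalTree T) :
    (treeValue D T).Nonempty := by
  have := h.compactSpace
  have hclosed : ∀ n : ℕ,
      IsClosed (⋃ s ∈ {s : List (Fin k) | T s = true ∧ s.length = n}, range (applyDigits D s)) :=
    fun n => Finite.isClosed_biUnion ((List.finite_length_eq _ n).subset fun s hs => hs.2)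
      fun s _ => h.isClosed_range s
  refine IsCompact.nonempty_iInter_of_sequence_nonempty_isCompact_isClosed _ (fun n => ?_)
    (fun n => ?_) (hclosed 0).isCompact hclosed
  · refine iUnion₂_subset fun s hs => ?_
    obtain ⟨hsT, hsl⟩ := hs
    obtain rfl | ⟨t, d, rfl⟩ := s.eq_nil_or_concat'
    · simp at hsl
    · refine (range_applyDigits_append_subset t [d]).trans ?_
      exact subset_biUnion_of_mem (u := fun s => range (applyDigits D s))
        (show t ∈ {s : List (Fin k) | T s = true ∧ s.length = n} from
          ⟨hT.prefix_closed t d hsT, by simpa using hsl⟩)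
  · obtain ⟨s, hs⟩ := hT.exists_length n
    obtain ⟨x⟩ := h.nonempty
    exact ⟨applyDigits D s x, mem_biUnion hs (mem_range_self x)⟩

theorem image_treeValue_subset {X : Type*} {D : Fin k → X → X}
    {T : List (Fin k) → Bool} (hT : IsDigitalTree T) (d : Fin k) :
    D d '' treeValue D (fun s => T (d :: s)) ⊆ treeValue D T := by
  rintro _ ⟨y, hy, rfl⟩
  refine mem_treeValue.2 fun n => ?_
  rw [mem_treeValue] at hy
  cases n with
  | zero => exact ⟨[], ⟨hT.nil, rfl⟩, _, rfl⟩
  | succ n =>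
    obtain ⟨s, ⟨hs, hl⟩, z, rfl⟩ := hy n
    exact ⟨d :: s, ⟨hs, by simp [hl]⟩, z, rfl⟩

/-- Every node of a digital tree contributes to its value. -/
theorem exists_mem_treeValue (h : IsDigitSpace D) {T : List (Fin k) → Bool} (hT : IsDigitalTree T)
    {s : List (Fin k)} (hs : T s = true) :
    ∃ x ∈ treeValue D T, x ∈ range (applyDigits D s) := by
  induction s generalizing T with
  | nil =>
    obtain ⟨x, hx⟩ := nonempty_treeValue h hT
    exact ⟨x, hx, x, rfl⟩
  | cons d s ih =>
    have hd : T [d] = true := hT.of_append (s := [d]) (t := s) hs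
    obtain ⟨_, hx, z, rfl⟩ := ih (hT.subtree hd) hs
    exact ⟨_, image_treeValue_subset hT d (mem_image_of_mem _ hx), z, rfl⟩

theorem treeValue_eq_iUnion {X : Type*} {D : Fin k → X → X}
    (hinj : ∀ d, Function.Injective (D d)) {T : List (Fin k) → Bool}
    (hT : IsDigitalTree T) :
    treeValue D T = ⋃ d : {d : Fin k // T [d] = true},
      D d.1 '' treeValue D (fun s => T (d.1 :: s)) := by
  refine Subset.antisymm (fun x hx => ?_) (iUnion_subset fun d => image_treeValue_subset hT d.1)
  rw [mem_treeValue] at hx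
  obtain ⟨d, hd⟩ : ∃ d : Fin k, ∀ n, ∃ s : List (Fin k), (T (d :: s) = true ∧ s.length = n) ∧
      x ∈ range (applyDigits D (d :: s)) := by
    -- König's argument: if every first digit `d` failed at some length `n d`, a word longer than
    -- all `n d` would, once truncated, contradict the failure of its own first digit.
    by_contra! hcon
    choose n hn using hcon
    obtain ⟨s, ⟨hs, hl⟩, hxs⟩ := hx (Finset.univ.sup n + 1)
    obtain _ | ⟨d, s⟩ := s
    · simp at hl
    · have hle : n d ≤ s.length := by
        have := Finset.le_sup (f := n) (Finset.mem_univ d)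
        simp only [List.length_cons] at hl
        omega
      rw [← List.take_append_drop (n d) s, ← List.cons_append] at hs hxs
      exact hn d (s.take (n d)) ⟨hT.of_append hs, by simp [hle]⟩
        (range_applyDigits_append_subset _ _ hxs)
  obtain ⟨s₀, ⟨hs₀, hl₀⟩, y, rfl⟩ := hd 0
  obtain rfl := List.length_eq_zero_iff.1 hl₀
  refine mem_iUnion.2 ⟨⟨d, hs₀⟩, y, mem_treeValue.2 fun n => ?_, rfl⟩
  obtain ⟨s, hs, z, hz⟩ := hd n
  exact ⟨s, hs, z, hinj d hz⟩

/-- A point of the value shares arbitrarily small word images with points of `K`, so it lies in the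
closure of `K`. -/
theorem treeValue_eq_of_forall (h : IsDigitSpace D) {T : List (Fin k) → Bool} {K : Set X}
    (hK : IsClosed K)
    (h₁ : ∀ x ∈ K, ∀ n, ∃ s, (T s = true ∧ s.length = n) ∧ x ∈ range (applyDigits D s))
    (h₂ : ∀ s, T s = true → ∃ x ∈ K, x ∈ range (applyDigits D s)) : treeValue D T = K := by
  refine Subset.antisymm (fun x hx => ?_) fun x hx => mem_treeValue.2 (h₁ x hx)
  rw [mem_treeValue] at hx
  obtain ⟨lev, -, hlev⟩ := h.exists_level
  rw [← hK.closure_eq, Metric.mem_closure_iff]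
  intro ε hε
  obtain ⟨m, hm⟩ := exists_pow_lt_of_lt_one hε (show (1 / 2 : ℝ) < 1 by norm_num)
  obtain ⟨s, ⟨hs, hl⟩, a, rfl⟩ := hx (lev m)
  obtain ⟨_, hy, b, rfl⟩ := h₂ s hs
  exact ⟨_, hy, (hlev m s hl a b).trans hm⟩

theorem coindTreeName_iff (h : IsDigitSpace D) (hinj : ∀ d, Function.Injective (D d))
    {T : List (Fin k) → Bool} {A : NonemptyCompacts X} :
    CoindTreeName D T A ↔ TreeName D T A := by
  have := h.compactSpace
  constructor
  · rintro ⟨R, hR, hTA⟩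
    refine ⟨(hR _ _ hTA).1, treeValue_eq_of_forall h A.isCompact.isClosed ?_ ?_⟩
    · intro x hx n
      induction n generalizing T A x with
      | zero => exact ⟨[], ⟨(hR _ _ hTA).1.nil, rfl⟩, x, rfl⟩
      | succ n ih =>
        obtain ⟨-, B, hB, hRB⟩ := hR _ _ hTA
        rw [hB] at hx
        obtain ⟨d, y, hy, rfl⟩ := mem_iUnion.1 hx
        obtain ⟨s, ⟨hs, hl⟩, z, rfl⟩ := ih (hRB d) y hy
        exact ⟨d :: s, ⟨hs, by simp [hl]⟩, z, rfl⟩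
    · intro s hs
      induction s generalizing T A with
      | nil =>
        obtain ⟨x, hx⟩ := A.nonempty
        exact ⟨x, hx, x, rfl⟩
      | cons d s ih =>
        obtain ⟨hT, B, hB, hRB⟩ := hR _ _ hTA
        have hd : T [d] = true := hT.of_append (s := [d]) (t := s) hs
        obtain ⟨_, hy, z, rfl⟩ := ih (hRB ⟨d, hd⟩) hs
        exact ⟨_, hB ▸ mem_iUnion.2 ⟨⟨d, hd⟩, mem_image_of_mem _ hy⟩, z, rfl⟩
  · intro hTA
    -- `TreeName` is its own coinduction witness, by the decomposition of a value into the values of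
    -- the immediate subtrees.
    refine ⟨TreeName D, fun S K hSK => ⟨hSK.1, ?_⟩, hTA⟩
    obtain ⟨hS, hK⟩ := hSK
    refine ⟨fun d => ⟨⟨treeValue D fun s => S (d.1 :: s), (isClosed_treeValue h _).isCompact⟩,
      nonempty_treeValue h (hS.subtree d.2)⟩, ?_, fun d => ⟨hS.subtree d.2, rfl⟩⟩
    rw [← hK, treeValue_eq_iUnion hinj hS]
    rfl

end DigitSpaceGeometry

section BasicAlgorithms

variable {X : Type*} [MetricSpace X] {k : ℕ} {D : Fin k → X → X} {u : ℕ → X}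

/-! ### Basic algorithms on a computable digit space -/

theorem codedPosRat_two_pow (n : ℕ) : codedPosRat (0, 2 ^ n - 1) = (1 / 2 : ℝ) ^ n := by
  simp [codedPosRat, Nat.cast_sub Nat.one_le_two_pow]

theorem codedRat_two_pow (a n : ℕ) : codedRat (a, 0, 2 ^ n - 1) = a * (1 / 2 : ℝ) ^ n := by
  simp [codedRat, Nat.cast_sub Nat.one_le_two_pow, div_eq_mul_inv]

theorem computable_two_pow_sub_one : Computable fun n : ℕ => 2 ^ n - 1 :=
  Primrec.nat_sub.to_comp.comp Computable.two_pow (Computable.const 1)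

theorem DecidableDigitSpace.exists_test (h : DecidableDigitSpace D u) (N : ℕ) :
    ∃ test : ℕ × Fin k → Bool, Computable test ∧
      ∀ i d, test (i, d) = true ↔ ball (u i) ((1 / 2 : ℝ) ^ N) ⊆ range (D d) := by
  obtain ⟨inst, hcomp⟩ := h
  refine ⟨_, hcomp.comp (Computable.fst.pair ((Computable.const (0, 2 ^ N - 1)).pair .snd)), ?_⟩
  intro i d
  rw [← codedPosRat_two_pow]
  exact decide_eq_true_iff

/-- By compactness, balls of a fixed radius are contained in images of digits, and such digits
can be computed. -/
theorem exists_digit_of_ball (h : IsDigitSpace D) (hcover : WellCovering D)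
    (hdec : DecidableDigitSpace D u) :
    ∃ (N : ℕ) (dig : ℕ → Fin k), Computable dig ∧
      ∀ i, ball (u i) ((1 / 2 : ℝ) ^ N) ⊆ range (D (dig i)) := by
  have := h.compactSpace
  -- Only the existence of a Lebesgue number is needed: `N` is a constant of the program.
  obtain ⟨δ, hδ, hball⟩ := lebesgue_number_lemma_of_metric (s := (univ : Set X)) isCompact_univ
    (c := fun d => interior (range (D d))) (fun d => isOpen_interior)
    fun x _ => mem_iUnion.2 (hcover x)
  obtain ⟨N, hN⟩ := exists_pow_lt_of_lt_one hδ (show (1 / 2 : ℝ) < 1 by norm_num)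
  obtain ⟨test, htest, htest_iff⟩ := hdec.exists_test N
  obtain ⟨x⟩ := h.nonempty
  obtain ⟨d₀, -⟩ := hcover x
  let L : ℕ → List (Fin k) := fun i =>
    (List.finRange k).flatMap fun d => bif test (i, d) then [d] else []
  have hL : Computable L :=
    Computable.list_flatMap (Computable.const _) (Computable.cond htest
      (Computable.list_cons.comp .snd (Computable.const [])) (Computable.const [])).to₂
  have hmem : ∀ i d, d ∈ L i ↔ ball (u i) ((1 / 2 : ℝ) ^ N) ⊆ range (D d) := by
    intro i d
    have : d ∈ L i ↔ test (i, d) = true := by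
      simp only [L, List.mem_flatMap, List.mem_finRange, true_and]
      constructor
      · rintro ⟨e, he⟩
        cases hte : test (i, e) <;> simp [hte] at he
        rw [he, hte]
      · intro hd
        exact ⟨d, by simp [hd]⟩
    rw [this, htest_iff]
  refine ⟨N, fun i => (L i).head?.getD d₀, Computable.option_getD
    (Primrec.list_head?.to_comp.comp hL) (Computable.const _), fun i => (hmem i _).1 ?_⟩
  obtain ⟨d, hd⟩ := hball (u i) (mem_univ _)
  have hd' : d ∈ L i :=
    (hmem i d).2 ((ball_subset_ball hN.le).trans (hd.trans interior_subset))
  cases hLi : L i with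
  | nil => simp [hLi] at hd'
  | cons e l => simp [hLi]

/-- Approximations of a point in the image of a digit yield approximations of its preimage. -/
theorem exists_preimage_approximation (N : ℕ) (hdec : DecidableDigitSpace D u)
    (hinv : UniformlyInvertible D) (hdense : ConstructivelyDense D u) :
    ∃ (G : ℕ → ℕ) (inv : Fin k × ℕ × ℕ → ℕ), Computable G ∧ Computable inv ∧
      (∀ n, n < G n ∧ N ≤ G n) ∧
      ∀ d n i y, ball (u i) ((1 / 2 : ℝ) ^ N) ⊆ range (D d) →
        dist (D d y) (u i) < (1 / 2 : ℝ) ^ G n → dist y (u (inv (d, n, i))) < (1 / 2 : ℝ) ^ n := by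
  obtain ⟨m, hm, hmD⟩ := hinv
  obtain ⟨φ, hφ, hφD⟩ := hdense
  obtain ⟨test, htest, htest_iff⟩ := hdec.exists_test N
  -- The modulus at `2⁻ⁿ` is at least `1 / (b n + 1)`. Half of this bound, coded by `(0, b n + b n +
  -- 1)`, is allotted to each of the two errors.
  let b : ℕ → ℕ := fun n => (m (0, 2 ^ n - 1)).2
  have hb : Computable b :=
    Computable.snd.comp (hm.comp ((Computable.const 0).pair computable_two_pow_sub_one))
  have hadd : ∀ {f g : ℕ → ℕ}, Computable f → Computable g → Computable fun n => f n + g n :=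
    fun hf hg => Primrec.nat_add.to_comp.comp hf hg
  -- The search `φ` may diverge off the image of the digit; guarding it by the ball test makes the
  -- procedure total.
  let f : Fin k × ℕ × ℕ →. ℕ := fun t =>
    cond (test (t.2.2, t.1))
      (φ ((0, b t.2.1 + b t.2.1 + 1), t.1, t.2.2)) (Part.some 0)
  have hf : Partrec f := by
    refine Partrec.cond (htest.comp ((Computable.snd.comp .snd).pair .fst)) (hφ.comp ?_)
      (Computable.const 0).partrec
    exact ((Computable.const 0).pair ((hadd (hadd hb hb) (Computable.const 1)).comp
      (Computable.fst.comp .snd))).pair (Computable.fst.pair (Computable.snd.comp .snd))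
  have hex : ∀ t, ∃ j, j ∈ f t ∧ (ball (u t.2.2) ((1 / 2 : ℝ) ^ N) ⊆ range (D t.1) →
      dist (u t.2.2) (D t.1 (u j)) < codedPosRat (0, b t.2.1 + b t.2.1 + 1)) := by
    intro t
    by_cases ht : test (t.2.2, t.1) = true
    · obtain ⟨j, hj, hd⟩ := hφD (0, b t.2.1 + b t.2.1 + 1) t.1 t.2.2
        ((htest_iff _ _).1 ht (mem_ball_self (by positivity)))
      exact ⟨j, by simpa [f, ht] using hj, fun _ => hd⟩
    · refine ⟨0, by simp [f, ht], fun h => absurd ((htest_iff _ _).2 h) ht⟩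
  choose inv hinv_mem hinv using hex
  -- The summand `b n` gives the required precision because `b n + 1 ≤ 2 ^ b n`; `N` and `n` secure
  -- the two lower bounds on `G`.
  refine ⟨fun n => b n + N + n + 2, inv, hadd (hadd (hadd hb (Computable.const N)) Computable.id)
    (Computable.const 2), hf.of_eq_tot hinv_mem,
    fun n => ⟨by dsimp only; omega, by dsimp only; omega⟩, ?_⟩
  intro d n i y hball hy
  rw [← codedPosRat_two_pow n]
  refine hmD _ d _ _ ?_
  have h1 := hinv (d, n, i) hball
  have h2 : (1 / 2 : ℝ) ^ (b n + N + n + 2) ≤ codedPosRat (0, b n + b n + 1) := by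
    have h3 : ((b n : ℝ) + 1) ≤ 2 ^ b n := by
      exact_mod_cast Nat.succ_le_of_lt (Nat.lt_two_pow_self (n := b n))
    calc (1 / 2 : ℝ) ^ (b n + N + n + 2) ≤ (1 / 2 : ℝ) ^ (b n + 1) :=
        pow_le_pow_of_le_one (by norm_num) (by norm_num) (by omega)
      _ = 1 / (2 * 2 ^ b n) := by rw [one_div_pow, pow_succ']
      _ ≤ 1 / (2 * ((b n : ℝ) + 1)) := one_div_le_one_div_of_le (by positivity) (by linarith)
      _ = codedPosRat (0, b n + b n + 1) := by
        simp only [codedPosRat]; push_cast; congr 1 <;> ring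
  have h4 : codedPosRat (0, b n + b n + 1) + codedPosRat (0, b n + b n + 1) ≤
      codedPosRat (m (0, 2 ^ n - 1)) := by
    simp only [codedPosRat]
    change _ ≤ _ / ((b n : ℝ) + 1)
    rw [← add_div, div_le_div_iff₀ (by positivity) (by positivity)]
    push_cast
    nlinarith [mul_nonneg (Nat.cast_nonneg (α := ℝ) (m (0, 2 ^ n - 1)).1)
      (Nat.cast_nonneg (α := ℝ) (b n)), Nat.cast_nonneg (α := ℝ) (m (0, 2 ^ n - 1)).1]
  calc dist (D d y) (D d (u (inv (d, n, i))))
      ≤ dist (D d y) (u i) + dist (u i) (D d (u (inv (d, n, i)))) := dist_triangle _ _ _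
    _ < codedPosRat (0, b n + b n + 1) + codedPosRat (0, b n + b n + 1) :=
      add_lt_add (hy.trans_le h2) h1
    _ ≤ _ := h4

/-- An approximate decision procedure for closeness of basic elements. -/
theorem exists_closeness_test (h : IsComputableMetricSpace u) :
    ∃ close : ℕ × ℕ × ℕ → Bool, Computable close ∧ ∀ i j n,
      (dist (u i) (u j) < 2 * (1 / 2 : ℝ) ^ n → close (i, j, n) = true) ∧
      (close (i, j, n) = true → dist (u i) (u j) < 4 * (1 / 2 : ℝ) ^ n) := by
  have hcode : ∀ a : ℕ, Computable fun t : ℕ × ℕ × ℕ => (t.1, t.2.1, (a, 0, 2 ^ t.2.2 - 1)) :=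
    fun a => Computable.fst.pair ((Computable.fst.comp .snd).pair ((Computable.const a).pair
      ((Computable.const 0).pair (computable_two_pow_sub_one.comp (Computable.snd.comp .snd)))))
  have hf := Partrec.map (Partrec.comp h.lt_re (hcode 4)) (Computable.const true).to₂
  have hg := Partrec.map (Partrec.comp h.gt_re (hcode 2)) (Computable.const false).to₂
  -- The two semidecidable conditions overlap and exhaust all cases, so one search always halts; in
  -- the overlap either answer is acceptable.
  obtain ⟨c, hc, H⟩ := Partrec.merge' hf hg
  have hex : ∀ t : ℕ × ℕ × ℕ, ∃ b, b ∈ c t ∧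
      (dist (u t.1) (u t.2.1) < 2 * (1 / 2 : ℝ) ^ t.2.2 → b = true) ∧
      (b = true → dist (u t.1) (u t.2.1) < 4 * (1 / 2 : ℝ) ^ t.2.2) := by
    intro t
    obtain ⟨H₁, H₂⟩ := H t
    have hpos : (0 : ℝ) < (1 / 2 : ℝ) ^ t.2.2 := by positivity
    have hdom : (c t).Dom := by
      rw [H₂]
      by_cases hlt : dist (u t.1) (u t.2.1) < 4 * (1 / 2 : ℝ) ^ t.2.2
      · left
        exact ⟨by simpa [codedRat_two_pow] using hlt, trivial⟩
      · right
        have : 2 * (1 / 2 : ℝ) ^ t.2.2 < dist (u t.1) (u t.2.1) := by linarith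
        exact ⟨by simpa [codedRat_two_pow] using this, trivial⟩
    refine ⟨(c t).get hdom, Part.get_mem _, ?_⟩
    have := H₁ _ (Part.get_mem hdom)
    simp only [Part.mem_map_iff, Part.mem_assert_iff, codedRat_two_pow] at this
    push_cast at this
    obtain ⟨_, ⟨h4, -⟩, hb⟩ | ⟨_, ⟨h2, -⟩, hb⟩ := this
    · exact ⟨fun _ => hb.symm, fun _ => h4⟩
    · exact ⟨fun h2' => absurd h2' h2.le.not_gt, fun h' => by rw [← hb] at h'; simp at h'⟩
  choose close hmem hclose using hex
  exact ⟨close, hc.of_eq_tot hmem, fun i j n => hclose (i, j, n)⟩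

/-- Values of compositions of digits can be approximated. -/
theorem exists_word_approximation (h : IsComputableDigitSpace D u) :
    ∃ ap : List (Fin k) × ℕ → ℕ, Computable ap ∧ ∀ s n,
      dist (applyDigits D s (u 0)) (u (ap (s, n))) ≤ s.length * (1 / 2 : ℝ) ^ n := by
  choose g hg hgD using fun d => (h.digit d).approx
  have hg' : Computable₂ fun (d : Fin k) (p : ℕ × ℕ) => g d p.1 p.2 :=
    Computable.of_finite_family fun d => hg d
  have hstep : Computable₂ fun (p : List (Fin k) × ℕ) (q : Fin k × ℕ) => g q.1 q.2 p.2 :=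
    (hg'.comp (Computable.fst.comp .snd)
      ((Computable.snd.comp .snd).pair (Computable.snd.comp .fst))).to₂
  refine ⟨fun p => p.1.foldr (fun d i => g d i p.2) 0,
    Computable.list_foldr .fst (Computable.const 0) hstep, fun s n => ?_⟩
  induction s with
  | nil => simp [applyDigits]
  | cons d s ih =>
    -- Digits do not expand distances, so each letter only adds one new rounding error.
    have h1 := h.digitSpace.dist_le d (applyDigits D s (u 0))
      (u (s.foldr (fun d i => g d i n) 0))
    have h2 := hgD d (s.foldr (fun d i => g d i n) 0) n
    have h3 := dist_triangle (D d (applyDigits D s (u 0)))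
      (D d (u (s.foldr (fun d i => g d i n) 0)))
      (u (g d (s.foldr (fun d i => g d i n) 0) n))
    simp only [List.foldr_cons, List.length_cons, applyDigits] at *
    push_cast
    linarith

end BasicAlgorithms

/-! ### Computing the digits of a point from approximations. -/

theorem Computable.iterate {α : Type*} [Primcodable α] {f : α → α} (hf : Computable f) :
    Computable₂ fun (a : α) (n : ℕ) => f^[n] a := by
  have hstep : Computable₂ fun (_ : α × ℕ) (q : ℕ × α) => f q.2 :=
    (hf.comp (Computable.snd.comp .snd)).to₂
  refine (Computable.nat_rec Computable.snd Computable.fst hstep).of_eq fun p => ?_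
  induction p.2 with
  | zero => rfl
  | succ n ih => exact (congrArg f ih).trans (Function.iterate_succ_apply' f n p.1).symm

theorem getI_map_range {α : Type*} [Inhabited α] (f : ℕ → α) {n j : ℕ} (hj : j < n) :
    ((List.range n).map f).getI j = f j := by
  rw [List.getI_eq_getElem _ (by simpa using hj)]
  simp

section DigitAlgorithm

variable {X : Type*} [MetricSpace X] {k : ℕ} {D : Fin k → X → X} {u : ℕ → X}

/-- Given approximations of a point, compute approximations of its preimage under the first
digit. -/
def tailApprox (dig : ℕ → Fin k) (inv : Fin k × ℕ × ℕ → ℕ) (m : ℕ → ℕ) (l : List ℕ) : List ℕ :=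
  (List.range (l.length - 1)).map fun j => inv (dig l.headI, m j, l.getI (j + 1))

/-- The digits computed from a list of approximations. -/
def digitWord (dig : ℕ → Fin k) (inv : Fin k × ℕ × ℕ → ℕ) (m : ℕ → ℕ) (l : List ℕ) :
    List (Fin k) :=
  (List.range l.length).map fun t => dig ((tailApprox dig inv m)^[t] l).headI

theorem digitWord_cons (dig : ℕ → Fin k) (inv : Fin k × ℕ × ℕ → ℕ) (m : ℕ → ℕ) (i : ℕ)
    (l : List ℕ) : digitWord dig inv m (i :: l) =
      dig i :: digitWord dig inv m (tailApprox dig inv m (i :: l)) := by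
  simp [digitWord, List.range_succ_eq_map, tailApprox, Function.comp_def]

theorem length_digitWord (dig : ℕ → Fin k) (inv : Fin k × ℕ × ℕ → ℕ) (m : ℕ → ℕ)
    (l : List ℕ) : (digitWord dig inv m l).length = l.length := by
  simp [digitWord]

/-- Digits already produced never depend on later approximations. This makes the outputs cohere into
a stream, and for compact sets into a prefix-closed tree. -/
theorem digitWord_concat (dig : ℕ → Fin k) (inv : Fin k × ℕ × ℕ → ℕ) (m : ℕ → ℕ)
    (l : List ℕ) (a : ℕ) :
    ∃ d, digitWord dig inv m (l ++ [a]) = digitWord dig inv m l ++ [d] := by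
  induction hn : l.length generalizing l a with
  | zero =>
    obtain rfl := List.length_eq_zero_iff.1 hn
    exact ⟨dig a, by simp [digitWord]⟩
  | succ n ih =>
    obtain _ | ⟨i, l⟩ := l
    · simp at hn
    have htail : tailApprox dig inv m (i :: (l ++ [a])) =
        tailApprox dig inv m (i :: l) ++ [inv (dig i, m l.length, a)] := by
      have hlen : (i :: (l ++ [a])).length - 1 = l.length + 1 := by simp
      unfold tailApprox
      rw [hlen, List.range_succ, List.map_append]
      congr 1
      · refine List.map_congr_left fun j hj => ?_
        have hj : j < l.length := by simpa using hj
        rw [List.getI_cons_succ, List.getI_cons_succ, List.getI_append _ _ _ hj]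
        rfl
      · simp [List.getI_append_right]
    obtain ⟨d, hd⟩ := ih (tailApprox dig inv m (i :: l)) (inv (dig i, m l.length, a))
      (by simpa [tailApprox] using hn)
    exact ⟨d, by rw [List.cons_append, digitWord_cons, htail, hd, digitWord_cons]; rfl⟩

theorem Computable.digitWord {dig : ℕ → Fin k} {inv : Fin k × ℕ × ℕ → ℕ} {m : ℕ → ℕ}
    (hdig : Computable dig) (hinv : Computable inv) (hm : Computable m) :
    Computable (digitWord dig inv m) := by
  have hentry : Computable₂ fun (l : List ℕ) (j : ℕ) =>
      inv (dig l.headI, m j, l.getI (j + 1)) := by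
    refine hinv.comp (Computable.pair (hdig.comp (Primrec.list_headI.to_comp.comp .fst))
      (Computable.pair (hm.comp .snd) ?_))
    exact Primrec.list_getI.to_comp.comp .fst (Computable.succ.comp .snd)
  have htail : Computable (tailApprox dig inv m) :=
    Computable.list_map (Primrec.list_range.to_comp.comp
      (Computable.pred.comp Computable.list_length)) hentry
  exact Computable.list_map (Primrec.list_range.to_comp.comp Computable.list_length)
    (hdig.comp (Primrec.list_headI.to_comp.comp (Computable.iterate htail))).to₂

/-- An algorithm that computes the digits of a point, one by one, from approximations of
precisions that are known in advance. -/
theorem exists_digit_algorithm (h : IsDigitSpace D) (hcover : WellCovering D)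
    (hdec : DecidableDigitSpace D u) (hinv : UniformlyInvertible D)
    (hdense : ConstructivelyDense D u) :
    ∃ (m : ℕ → ℕ) (w : List ℕ → List (Fin k)), Computable m ∧ Computable w ∧
      (∀ j, m j < m (j + 1)) ∧ (∀ l, (w l).length = l.length) ∧
      (∀ l a, ∃ d, w (l ++ [a]) = w l ++ [d]) ∧
      ∀ l x, (∀ j < l.length, dist x (u (l.getI j)) < (1 / 2 : ℝ) ^ m j) →
        x ∈ range (applyDigits D (w l)) := by
  obtain ⟨N, dig, hdig, hball⟩ := exists_digit_of_ball h hcover hdec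
  obtain ⟨G, inv, hG, hinvc, hGN, hinv⟩ :=
    exists_preimage_approximation (N + 2) hdec hinv hdense
  -- Passing to the preimage lowers precision `G (m j)` to `m j` and shifts the list by one, so
  -- entry `j` still has precision `N + 2` when it determines digit `j`.
  let m : ℕ → ℕ := fun j => G^[j] (N + 2)
  have hmsucc : ∀ j, m (j + 1) = G (m j) := fun j => Function.iterate_succ_apply' _ _ _
  have hm : Computable m := (Computable.iterate hG).comp (Computable.const _) Computable.id
  refine ⟨m, digitWord dig inv m, hm, Computable.digitWord hdig hinvc hm, fun j => ?_,
    length_digitWord dig inv m, digitWord_concat dig inv m, fun l x hl => ?_⟩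
  · rw [hmsucc]
    exact (hGN _).1
  induction hn : l.length generalizing l x with
  | zero =>
    obtain rfl := List.length_eq_zero_iff.1 hn
    exact ⟨x, rfl⟩
  | succ n ih =>
    obtain _ | ⟨i, l⟩ := l
    · simp at hn
    have h0 : dist x (u i) < (1 / 2 : ℝ) ^ (N + 2) := hl 0 (by simp)
    have hpow : (1 / 2 : ℝ) ^ N = 4 * (1 / 2 : ℝ) ^ (N + 2) := by rw [pow_add]; ring
    have hpos : (0 : ℝ) < (1 / 2 : ℝ) ^ (N + 2) := by positivity
    obtain ⟨y, rfl⟩ := hball i (mem_ball.2 (hpow ▸ h0.trans (lt_mul_left hpos (by norm_num))))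
    have hlen : (tailApprox dig inv m (i :: l)).length = l.length := by simp [tailApprox]
    obtain ⟨z, rfl⟩ := ih (tailApprox dig inv m (i :: l)) y (fun j hj => by
      rw [hlen] at hj
      have hj' : dist (D (dig i) y) (u (l.getI j)) < (1 / 2 : ℝ) ^ m (j + 1) :=
        hl (j + 1) (by simpa using hj)
      have hentry : (tailApprox dig inv m (i :: l)).getI j = inv (dig i, m j, l.getI j) :=
        getI_map_range _ (by simpa using hj)
      rw [hentry]
      rw [hmsucc] at hj'
      -- Both `u i` and the later entry are within `2⁻⁽ᴺ⁺²⁾` of the point, so the small ball about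
      -- the later entry stays within three quarters of the radius `2⁻ᴺ` about `u i`.
      refine hinv _ _ _ _ (fun z hz => hball i ?_) hj'
      have hle : (1 / 2 : ℝ) ^ G (m j) ≤ (1 / 2 : ℝ) ^ (N + 2) :=
        pow_le_pow_of_le_one (by norm_num) (by norm_num) (hGN _).2
      have h1 := dist_triangle z (u (l.getI j)) (u i)
      have h2 := dist_triangle_left (u (l.getI j)) (u i) (D (dig i) y)
      rw [mem_ball] at hz ⊢
      have h3 := hj'.trans_le hle
      rw [hpow]
      generalize (1 / 2 : ℝ) ^ (N + 2) = r at h0 h3 hz hpos ⊢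
      linarith only [h0, h1, h2, hz, h3, hpos]) (by rw [hlen]; simpa using hn)
    rw [digitWord_cons]
    exact ⟨z, rfl⟩

end DigitAlgorithm

section Translations

variable {X : Type*} [MetricSpace X] {k : ℕ} {D : Fin k → X → X} {u : ℕ → X}

/-! ### Translations between names of points -/

theorem cauchyName_reducible_digitName (h : IsDigitSpace D) (hcover : WellCovering D)
    (hdec : DecidableDigitSpace D u) (hinv : UniformlyInvertible D)
    (hdense : ConstructivelyDense D u) :
    EffectivelyReducible (CauchyName u) (DigitName D) := by
  obtain ⟨m, w, hm, hw, -, hlen, hconcat, hmem⟩ :=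
    exists_digit_algorithm h hcover hdec hinv hdense
  obtain ⟨x₀⟩ := h.nonempty
  obtain ⟨d₀, -⟩ := hcover x₀
  have hsnd : Computable fun l : List (ℕ × ℕ) => l.map Prod.snd :=
    Computable.list_map Computable.id (Computable.snd.comp .snd).to₂
  refine EffectivelyReducible.of_computable (Q := fun n => (List.range (n + 1)).map m)
    (F := fun n l => (w (l.map Prod.snd))[n]?.getD d₀)
    (Computable.list_map (Primrec.list_range.to_comp.comp Computable.succ) (hm.comp .snd).to₂)
    (Computable.option_getD (Computable.list_getElem?.comp (hw.comp (hsnd.comp .snd)) .fst)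
      (Computable.const d₀)) fun p x hp => ?_
  refine (digitName_iff h).2 fun n => ?_
  have hlist : ∀ n, ((List.range n).map m |>.map fun a => (a, p a)).map Prod.snd =
      (List.range n).map fun j => p (m j) := fun n => by simp
  simp only [hlist]
  -- Letter `n` is read off from `n + 1` approximations, hence the default `d₀` never occurs; since
  -- words only grow, the letters assemble into a single word.
  have hword : ∀ n, (List.range n).map
      (fun n => (w ((List.range (n + 1)).map fun j => p (m j)))[n]?.getD d₀) =
      w ((List.range n).map fun j => p (m j)) := by
    intro n
    induction n with
    | zero =>
      have := hlen []
      exact (List.length_eq_zero_iff.1 this).symm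
    | succ n ih =>
      obtain ⟨d, hd⟩ := hconcat ((List.range n).map fun j => p (m j)) (p (m n))
      rw [List.range_succ, List.map_append, ih, List.map_append, List.map_singleton,
        List.map_singleton, List.range_succ, List.map_append, List.map_singleton, hd,
        List.getElem?_append_right (by simp [hlen])]
      simp [hlen]
  rw [hword]
  refine hmem _ _ fun j hj => ?_
  rw [getI_map_range _ (by simpa using hj)]
  exact hp _

theorem length_mul_half_pow_le {n l : ℕ} :
    (l : ℝ) * (1 / 2 : ℝ) ^ (l + n) ≤ (1 / 2 : ℝ) ^ n := by
  have h : (l : ℝ) ≤ 2 ^ l := by exact_mod_cast Nat.lt_two_pow_self.le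
  rw [pow_add, ← mul_assoc]
  refine mul_le_of_le_one_left (by positivity) ?_
  rw [one_div_pow, mul_one_div]
  exact div_le_one_of_le₀ h (by positivity)

/-- Words of a length that depends on the required precision determine points, and these can be
computed. -/
theorem exists_word_evaluation (h : IsComputableDigitSpace D u) :
    ∃ (lev : ℕ → ℕ) (ev : List (Fin k) × ℕ → ℕ), Computable lev ∧ Computable ev ∧
      ∀ n s, s.length = lev n → ∀ x ∈ range (applyDigits D s),
        dist x (u (ev (s, n))) < (1 / 2 : ℝ) ^ n := by
  obtain ⟨lev, hlev, hlevD⟩ := h.digitSpace.exists_level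
  obtain ⟨ap, hap, hapD⟩ := exists_word_approximation h
  have hadd : ∀ {f g : List (Fin k) × ℕ → ℕ}, Computable f → Computable g →
      Computable fun n => f n + g n := fun hf hg => Primrec.nat_add.to_comp.comp hf hg
  -- Half of the error is the diameter of the word image. The other half is rounding, where the
  -- extra `p.1.length` in the precision absorbs one error per letter.
  refine ⟨fun n => lev (n + 1), fun p => ap (p.1, p.1.length + (p.2 + 1)),
    hlev.comp Computable.succ,
    hap.comp (Computable.fst.pair (hadd (Computable.list_length.comp .fst)
      (Computable.succ.comp .snd))), ?_⟩
  rintro n s hs _ ⟨y, rfl⟩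
  have h1 := hlevD (n + 1) s hs y (u 0)
  have h2 := (hapD s (s.length + (n + 1))).trans length_mul_half_pow_le
  have h3 := dist_triangle (applyDigits D s y) (applyDigits D s (u 0))
    (u (ap (s, s.length + (n + 1))))
  have h4 : (1 / 2 : ℝ) ^ n = (1 / 2 : ℝ) ^ (n + 1) + (1 / 2 : ℝ) ^ (n + 1) := by ring
  dsimp only
  linarith

theorem digitName_reducible_cauchyName (h : IsComputableDigitSpace D u) :
    EffectivelyReducible (DigitName D) (CauchyName u) := by
  obtain ⟨lev, ev, hlev, hev, hevD⟩ := exists_word_evaluation h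
  have hsnd : Computable fun l : List (ℕ × Fin k) => l.map Prod.snd :=
    Computable.list_map Computable.id (Computable.snd.comp .snd).to₂
  refine EffectivelyReducible.of_computable (Q := fun n => List.range (lev n))
    (F := fun n l => ev (l.map Prod.snd, n))
    (Primrec.list_range.to_comp.comp hlev)
    (hev.comp ((hsnd.comp .snd).pair .fst)) fun α x hα n => ?_
  refine hevD n _ (by simp) x ?_
  have := (digitName_iff h.digitSpace).1 hα (lev n)
  simpa [Function.comp_def] using this

/-! ### Translations between names of compact sets -/

theorem HausdorffName.exists_dist_lt [CompactSpace X] {p : ℕ → List ℕ} {A : NonemptyCompacts X}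
    (h : HausdorffName u p A) (n : ℕ) :
    (∀ x ∈ A, ∃ i ∈ p n, dist x (u i) < (1 / 2 : ℝ) ^ n) ∧
      ∀ i ∈ p n, ∃ x ∈ A, dist x (u i) < (1 / 2 : ℝ) ^ n := by
  obtain ⟨hne, hd⟩ := h n
  obtain ⟨i₀, hi₀⟩ := List.exists_mem_of_ne_nil _ hne
  -- Nonemptiness of `p n` rules out the default value `0` that `hausdorffDist` takes at infinite
  -- distance.
  have hfin : hausdorffEDist (A : Set X) (u '' {i | i ∈ p n}) ≠ ⊤ :=
    hausdorffEDist_ne_top_of_nonempty_of_bounded A.nonempty ⟨_, mem_image_of_mem u hi₀⟩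
      isBounded_of_compactSpace isBounded_of_compactSpace
  constructor
  · intro x hx
    obtain ⟨_, ⟨i, hi, rfl⟩, hxi⟩ := exists_dist_lt_of_hausdorffDist_lt hx hd hfin
    exact ⟨i, hi, hxi⟩
  · intro i hi
    obtain ⟨x, hx, hxi⟩ := exists_dist_lt_of_hausdorffDist_lt' (mem_image_of_mem u hi) hd hfin
    exact ⟨x, hx, hxi⟩

theorem mem_sections_map_range {α : Type*} [Inhabited α] {f : ℕ → List α} {n : ℕ} {c : List α} :
    c ∈ ((List.range n).map f).sections ↔ c.length = n ∧ ∀ j < n, c.getI j ∈ f j := by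
  rw [List.mem_sections, List.forall₂_iff_get]
  simp only [List.length_map, List.length_range, List.get_eq_getElem, List.getElem_map,
    List.getElem_range]
  refine and_congr_right fun hn => ⟨fun H j hj => ?_, fun H j h₁ h₂ => ?_⟩
  · rw [List.getI_eq_getElem _ (hn ▸ hj)]
    exact H j (hn ▸ hj) hj
  · rw [← List.getI_eq_getElem]
    exact H j h₂

/-- The nodes are the words of chains, that is, of sequences with entry `j` in `p (e j)` and
neighbouring entries close. Each length admits finitely many candidates, so membership is decidable.
Approximations of a point of `A` form a chain, so the tree covers `A`; conversely a point of `A`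
near the last entry of a chain is near all its entries, so every node meets `A`. -/
theorem hausdorffName_reducible_treeName (h : IsComputableDigitSpace D u)
    (hcover : WellCovering D) (hdec : DecidableDigitSpace D u) (hinv : UniformlyInvertible D)
    (hdense : ConstructivelyDense D u) :
    EffectivelyReducible (HausdorffName u) (TreeName D) := by
  have := h.digitSpace.compactSpace
  obtain ⟨m, w, hm, hw, hmono, hlen, hconcat, hmem⟩ :=
    exists_digit_algorithm h.digitSpace hcover hdec hinv hdense
  obtain ⟨close, hclose, hcloseD⟩ := exists_closeness_test h.metric
  let e : ℕ → ℕ := fun j => m j + 3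
  have he : Computable e := Primrec.nat_add.to_comp.comp hm (Computable.const 3)
  let linked : List ℕ → Bool := fun c =>
    (List.range (c.length - 1)).all fun j => close (c.getI j, c.getI (j + 1), e j)
  have hlinked : Computable linked := by
    refine Computable.list_all (Primrec.list_range.to_comp.comp
      (Computable.pred.comp Computable.list_length)) (hclose.comp (Computable.pair ?_
      (Computable.pair ?_ (he.comp .snd))))
    · exact Primrec.list_getI.to_comp.comp .fst .snd
    · exact Primrec.list_getI.to_comp.comp .fst (Computable.succ.comp .snd)
  have hsnd : Computable fun l : List (ℕ × List ℕ) => l.map Prod.snd :=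
    Computable.list_map Computable.id (Computable.snd.comp .snd).to₂
  have heq : Computable₂ fun a b : List (Fin k) => decide (a = b) :=
    (Primrec.eq (α := List (Fin k))).decide.to_comp
  have htest : Computable₂ fun (q : List (Fin k) × List (ℕ × List ℕ)) (c : List ℕ) =>
      linked c && decide (w c = q.1) :=
    Primrec.and.to_comp.comp (hlinked.comp .snd)
      (heq.comp (hw.comp .snd) (Computable.fst.comp .fst))
  have hF : Computable₂ fun (s : List (Fin k)) (l : List (ℕ × List ℕ)) =>
      (l.map Prod.snd).sections.any fun c => linked c && decide (w c = s) :=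
    Computable.list_any (Computable.list_sections.comp (hsnd.comp .snd)) htest
  refine EffectivelyReducible.of_computable
    (Q := fun s : List (Fin k) => (List.range s.length).map e)
    (Computable.list_map (Primrec.list_range.to_comp.comp Computable.list_length)
      (he.comp .snd).to₂) hF fun p A hp => ?_
  set T : List (Fin k) → Bool := fun s => ((((List.range s.length).map e).map
    fun a => (a, p a)).map Prod.snd).sections.any fun c =>
      linked c && decide (w c = s) with hTdef
  -- Finite sequences of basic elements that approximate some point of `A`.
  let Chain : List ℕ → Prop := fun c => (∀ j < c.length, c.getI j ∈ p (e j)) ∧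
    ∀ j, j + 1 < c.length → close (c.getI j, c.getI (j + 1), e j) = true
  have hT : ∀ s, T s = true ↔ ∃ c, Chain c ∧ w c = s := by
    intro s
    have hmap : (((List.range s.length).map e).map fun a => (a, p a)).map Prod.snd =
        (List.range s.length).map fun j => p (e j) := by simp
    simp only [hTdef, hmap, List.any_eq_true, mem_sections_map_range, Bool.and_eq_true,
      decide_eq_true_eq, linked, List.all_eq_true, List.mem_range]
    constructor
    · rintro ⟨c, ⟨hcl, hc⟩, hlink, rfl⟩
      exact ⟨c, ⟨fun j hj => hc j (hcl ▸ hj), fun j hj => hlink j (by omega)⟩, rfl⟩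
    · rintro ⟨c, ⟨hc, hlink⟩, rfl⟩
      exact ⟨c, ⟨(hlen c).symm, fun j hj => hc j (hlen c ▸ hj)⟩, fun j hj => hlink j (by omega),
        rfl⟩
  have hhalf : ∀ j, (1 / 2 : ℝ) ^ e (j + 1) ≤ 1 / 2 * (1 / 2 : ℝ) ^ e j := by
    intro j
    rw [← pow_succ']
    exact pow_le_pow_of_le_one (by norm_num) (by norm_num)
      (by have := hmono j; simp only [e]; omega)
  have happrox : ∀ c (n : ℕ) x, Chain c → c.length = n + 1 →
      dist x (u (c.getI n)) < (1 / 2 : ℝ) ^ e n →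
      ∀ j < c.length, dist x (u (c.getI j)) < (1 / 2 : ℝ) ^ m j := by
    intro c n x hc hcn hx j hj
    have hjn : j ≤ n := by omega
    -- The `3` in `e` provides the factor 8, which is stable under downward induction: half of 8
    -- from the next entry plus 4 from the closeness test is again 8.
    have hem : (1 / 2 : ℝ) ^ m j = 8 * (1 / 2 : ℝ) ^ e j := by simp only [e, pow_add]; ring
    rw [hem]
    induction hjn using Nat.decreasingInduction with
    | self =>
      have : (0 : ℝ) < (1 / 2 : ℝ) ^ e n := by positivity
      linarith
    | of_succ j hjn ih =>
      have h1 := ih (by omega) (by simp only [e, pow_add]; ring)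
      have h2 := ((hcloseD _ _ _).2) (hc.2 j (by omega))
      have h3 := dist_triangle_right x (u (c.getI j)) (u (c.getI (j + 1)))
      have h4 := hhalf j
      linarith
  have hpoint : ∀ c, Chain c → ∃ x ∈ A,
      (∀ j < c.length, dist x (u (c.getI j)) < (1 / 2 : ℝ) ^ m j) ∧
      (∀ n, c.length = n + 1 → dist x (u (c.getI n)) < (1 / 2 : ℝ) ^ e n) := by
    intro c hc
    cases hcl : c.length with
    | zero =>
      obtain ⟨x, hx⟩ := A.nonempty
      exact ⟨x, hx, by simp, by simp⟩
    | succ n =>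
      obtain ⟨x, hx, hxn⟩ := (hp.exists_dist_lt (e n)).2 _ (hc.1 n (by omega))
      refine ⟨x, hx, hcl ▸ happrox c n x hc hcl hxn, fun n' hn' => ?_⟩
      obtain rfl : n = n' := by omega
      exact hxn
  have hnear : ∀ x i j n, dist x (u i) < (1 / 2 : ℝ) ^ e n →
      dist x (u j) < (1 / 2 : ℝ) ^ e (n + 1) → close (i, j, e n) = true := by
    intro x i j n hi hj
    refine (hcloseD _ _ _).1 ?_
    have h1 := dist_triangle_left (u i) (u j) x
    have h2 := hhalf n
    have h3 : (0 : ℝ) < (1 / 2 : ℝ) ^ e n := by positivity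
    linarith
  have htree : IsDigitalTree T := by
    refine ⟨(hT _).2 ⟨[], ⟨by simp, by simp⟩, List.length_eq_zero_iff.1 (hlen [])⟩,
      fun s d hs => ?_, fun s hs => ?_⟩
    · obtain ⟨c, hc, hcs⟩ := (hT _).1 hs
      obtain rfl | ⟨c, a, rfl⟩ := c.eq_nil_or_concat'
      · have := hlen []
        simp [hcs] at this
      · obtain ⟨d', hd'⟩ := hconcat c a
        have hws : w c = s := (List.append_inj' (hd'.symm.trans hcs) rfl).1
        refine (hT _).2 ⟨c, ⟨fun j hj => ?_, fun j hj => ?_⟩, hws⟩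
        · have := hc.1 j (by simp; omega)
          rwa [List.getI_append _ _ _ hj] at this
        · have := hc.2 j (by simp; omega)
          rwa [List.getI_append _ _ _ hj, List.getI_append _ _ _ (by omega)] at this
    · obtain ⟨c, hc, rfl⟩ := (hT _).1 hs
      -- An approximation of the same `x` at the next precision extends the chain; this needs the
      -- sharp bound at the last entry.
      obtain ⟨x, hx, -, hxlast⟩ := hpoint c hc
      obtain ⟨a, ha, hxa⟩ := (hp.exists_dist_lt (e c.length)).1 x hx
      obtain ⟨d, hd⟩ := hconcat c a
      have hlast : (c ++ [a]).getI c.length = a := by simp [List.getI_append_right]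
      refine ⟨d, (hT _).2 ⟨c ++ [a], ⟨fun j hj => ?_, fun j hj => ?_⟩, hd⟩⟩
      · obtain hj | rfl : j < c.length ∨ j = c.length := by simp at hj; omega
        · rw [List.getI_append _ _ _ hj]
          exact hc.1 j hj
        · rwa [hlast]
      · obtain hj | hj : j + 1 < c.length ∨ j + 1 = c.length := by simp at hj; omega
        · rw [List.getI_append _ _ _ hj, List.getI_append _ _ _ (by omega)]
          exact hc.2 j hj
        · rw [List.getI_append _ _ j (by omega), hj, hlast]
          exact hnear x _ _ _ (hxlast j hj.symm) (hj ▸ hxa)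
  refine ⟨htree, treeValue_eq_of_forall h.digitSpace A.isCompact.isClosed ?_ ?_⟩
  · intro x hx n
    choose i hi hxi using fun j => (hp.exists_dist_lt (e j)).1 x hx
    refine ⟨w ((List.range n).map i), ⟨(hT _).2 ⟨_, ⟨fun j hj => ?_, fun j hj => ?_⟩, rfl⟩,
      by simp [hlen]⟩, hmem _ _ fun j hj => ?_⟩
    · rw [getI_map_range _ (by simpa using hj)]
      exact hi j
    · have hj : j + 1 < n := by simpa using hj
      rw [getI_map_range _ hj, getI_map_range _ (by omega)]
      exact hnear x _ _ _ (hxi j) (hxi (j + 1))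
    · rw [getI_map_range _ (by simpa using hj)]
      exact (hxi j).trans_le (pow_le_pow_of_le_one (by norm_num) (by norm_num) (by simp [e]))
  · intro s hs
    obtain ⟨c, hc, rfl⟩ := (hT _).1 hs
    obtain ⟨x, hx, hxc, -⟩ := hpoint c hc
    exact ⟨x, hx, hmem _ _ hxc⟩

theorem treeName_reducible_hausdorffName (h : IsComputableDigitSpace D u) :
    EffectivelyReducible (TreeName D) (HausdorffName u) := by
  obtain ⟨lev, ev, hlev, hev, hevD⟩ := exists_word_evaluation h
  let words : ℕ → List (List (Fin k)) := fun n =>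
    ((List.range n).map fun _ => List.finRange k).sections
  have hwords : Computable words :=
    Computable.list_sections.comp (Computable.list_map Primrec.list_range.to_comp
      (Computable.const _).to₂)
  have hmem_words : ∀ n s, s ∈ words n ↔ s.length = n := by
    intro n s
    simp only [words, List.mem_sections, List.forall₂_iff_get]
    simp
  have hnodes : Computable fun l : List (List (Fin k) × Bool) =>
      l.flatMap fun a => bif a.2 then [a.1] else [] :=
    Computable.list_flatMap Computable.id (Computable.cond (Computable.snd.comp .snd)
      (Computable.list_cons.comp (Computable.fst.comp .snd) (Computable.const []))
      (Computable.const [])).to₂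
  have hF : Computable₂ fun (n : ℕ) (l : List (List (Fin k) × Bool)) =>
      (l.flatMap fun a => bif a.2 then [a.1] else []).map fun s => ev (s, n + 1) :=
    Computable.list_map (hnodes.comp .snd)
      (hev.comp (Computable.snd.pair (Computable.succ.comp (Computable.fst.comp .fst)))).to₂
  refine EffectivelyReducible.of_computable (Q := fun n => words (lev (n + 1)))
    (hwords.comp (hlev.comp Computable.succ)) hF fun T A hTA n => ?_
  obtain ⟨hT, hA⟩ := hTA
  have hmem : ∀ i, i ∈ (((words (lev (n + 1))).map fun a => (a, T a)).flatMap
      fun a => bif a.2 then [a.1] else []).map (fun s => ev (s, n + 1)) ↔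
      ∃ s, (T s = true ∧ s.length = lev (n + 1)) ∧ ev (s, n + 1) = i := by
    intro i
    simp only [List.mem_map, List.mem_flatMap]
    refine exists_congr fun s => and_congr_left fun _ => ⟨?_, fun hs => ?_⟩
    · rintro ⟨_, ⟨t, ht, rfl⟩, hs⟩
      dsimp only at hs
      cases hTt : T t <;> simp only [hTt, cond_true, cond_false, List.mem_singleton,
        List.not_mem_nil] at hs
      exact hs ▸ ⟨hTt, (hmem_words _ _).1 ht⟩
    · exact ⟨_, ⟨s, (hmem_words _ _).2 hs.2, rfl⟩, by simp [hs.1]⟩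
  constructor
  · obtain ⟨s, hs⟩ := hT.exists_length (lev (n + 1))
    exact List.ne_nil_of_mem ((hmem _).2 ⟨s, hs, rfl⟩)
  -- Working at precision `n + 1` turns the weak bound on the Hausdorff distance into a strict one.
  · refine (hausdorffDist_le_of_mem_dist (r := (1 / 2 : ℝ) ^ (n + 1))
      (by positivity) ?_ ?_).trans_lt
      (pow_lt_pow_right_of_lt_one₀ (by norm_num) (by norm_num) (Nat.lt_succ_self n))
    · intro x hx
      rw [← hA, mem_treeValue] at hx
      obtain ⟨s, hs, hxs⟩ := hx (lev (n + 1))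
      exact ⟨_, ⟨_, (hmem _).2 ⟨s, hs, rfl⟩, rfl⟩, (hevD _ s hs.2 x hxs).le⟩
    · rintro _ ⟨i, hi, rfl⟩
      obtain ⟨s, hs, rfl⟩ := (hmem i).1 hi
      obtain ⟨x, hx, hxs⟩ := exists_mem_treeValue h.digitSpace hT hs.1
      refine ⟨x, hA ▸ hx, ?_⟩
      rw [dist_comm]
      exact (hevD _ s hs.2 x hxs).le

/-! ### The predicates hold universally -/

theorem cauchySet_eq_univ (h : DenseRange u) : cauchySet u = univ :=
  eq_univ_of_forall fun x n => h.exists_dist_lt x (by positivity) |>.elim fun i hi =>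
    ⟨u i, mem_range_self i, hi⟩

theorem coindSet_eq_univ {X : Type*} {D : Fin k → X → X} (h : ⋃ d, range (D d) = univ) :
    coindSet D = univ := by
  refine eq_univ_of_forall fun x => ⟨univ, fun y _ => ?_, mem_univ x⟩
  have hy : y ∈ ⋃ d, range (D d) := h ▸ mem_univ y
  obtain ⟨d, z, rfl⟩ := mem_iUnion.1 hy
  exact ⟨d, z, mem_univ z, rfl⟩

theorem exists_hausdorffName (h : DenseRange u) (A : NonemptyCompacts X) :
    ∃ p, HausdorffName u p A := by
  have H : ∀ n : ℕ, ∃ l : List ℕ, l ≠ [] ∧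
      hausdorffDist (A : Set X) (u '' {i | i ∈ l}) < (1 / 2 : ℝ) ^ n := by
    intro n
    choose i hi using fun x : X =>
      h.exists_dist_lt x (show (0 : ℝ) < (1 / 2 : ℝ) ^ (n + 2) by positivity)
    -- The centres lie in `A` and are then replaced by basic elements, at the cost of a second error
    -- `2⁻⁽ⁿ⁺²⁾`.
    obtain ⟨t, htA, ht, hcov⟩ := A.isCompact.finite_cover_balls
      (show (0 : ℝ) < (1 / 2 : ℝ) ^ (n + 2) by positivity)
    have hmem : ∀ j, j ∈ (ht.toFinset.toList.map i) ↔ ∃ x ∈ t, i x = j := by simp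
    obtain ⟨a, ha⟩ := A.nonempty
    have hball : ∀ x ∈ A, ∃ y ∈ t, dist x y < (1 / 2 : ℝ) ^ (n + 2) := by
      intro x hx
      simpa using hcov hx
    refine ⟨ht.toFinset.toList.map i, ?_, ?_⟩
    · obtain ⟨y, hy, -⟩ := hball a ha
      exact List.ne_nil_of_mem ((hmem _).2 ⟨y, hy, rfl⟩)
    · have hpow : (1 / 2 : ℝ) ^ (n + 1) = 2 * (1 / 2 : ℝ) ^ (n + 2) := by ring
      have hpos : (0 : ℝ) < (1 / 2 : ℝ) ^ (n + 2) := by positivity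
      refine (hausdorffDist_le_of_mem_dist (r := (1 / 2 : ℝ) ^ (n + 1))
        (by positivity) ?_ ?_).trans_lt
        (pow_lt_pow_right_of_lt_one₀ (by norm_num) (by norm_num) (Nat.lt_succ_self n))
      · intro x hx
        obtain ⟨y, hy, hxy⟩ := hball x hx
        refine ⟨_, ⟨_, (hmem _).2 ⟨y, hy, rfl⟩, rfl⟩, ?_⟩
        linarith [dist_triangle x y (u (i y)), hi y]
      · rintro _ ⟨j, hj, rfl⟩
        obtain ⟨y, hy, rfl⟩ := (hmem j).1 hj
        refine ⟨y, htA hy, ?_⟩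
        rw [dist_comm]
        linarith [hi y]
  choose p hp using H
  exact ⟨p, hp⟩

theorem cauchyCompacts_eq_univ (h : DenseRange u) : cauchyCompacts u = univ := by
  refine eq_univ_of_forall fun A n => ?_
  obtain ⟨p, hp⟩ := exists_hausdorffName h A
  obtain ⟨hne, hd⟩ := hp n
  obtain ⟨i, hi⟩ := List.exists_mem_of_ne_nil _ hne
  exact ⟨_, (List.finite_toSet (p n)).image u, ⟨_, mem_image_of_mem u hi⟩, image_subset_range _ _,
    hd⟩

theorem mem_coindCompacts_of_coindTreeName {T : List (Fin k) → Bool} {A : NonemptyCompacts X}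
    (h : CoindTreeName D T A) : A ∈ coindCompacts D := by
  obtain ⟨R, hR, hTA⟩ := h
  refine ⟨{K | ∃ S, R S K}, ?_, T, hTA⟩
  rintro K ⟨S, hSK⟩
  obtain ⟨-, B, hB, hRB⟩ := hR S K hSK
  exact ⟨{d | S [d] = true}, B, hB, fun d => ⟨_, hRB d⟩⟩

end Translations

theorem mainTheorem10 {X : Type*} [MetricSpace X] {k : ℕ} (D : Fin k → X → X) (u : ℕ → X)
    (hX : IsComputableDigitSpace D u) (hcover : WellCovering D) (hdec : DecidableDigitSpace D u)
    (hinv : UniformlyInvertible D) (hdense : ConstructivelyDense D u) :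
    (cauchySet u = coindSet D ∧
      EffectivelyEquivalent (CauchyName u) (CoindName D) ∧
      EffectivelyEquivalent (CauchyName u) (DigitName D)) ∧
    (cauchyCompacts u = coindCompacts D ∧
      EffectivelyEquivalent (HausdorffName u) (CoindTreeName D) ∧
      EffectivelyEquivalent (HausdorffName u) (TreeName D)) := by
  have hdigit : CoindName D = DigitName D := by
    funext α x
    exact propext ((coindName_iff hinv.injective).trans (digitName_iff hX.digitSpace).symm)
  have htree : CoindTreeName D = TreeName D := by
    funext T A
    exact propext (coindTreeName_iff hX.digitSpace hinv.injective)
  have hpoints : EffectivelyEquivalent (CauchyName u) (DigitName D) :=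
    ⟨cauchyName_reducible_digitName hX.digitSpace hcover hdec hinv hdense,
      digitName_reducible_cauchyName hX⟩
  have hsets : EffectivelyEquivalent (HausdorffName u) (TreeName D) :=
    ⟨hausdorffName_reducible_treeName hX hcover hdec hinv hdense,
      treeName_reducible_hausdorffName hX⟩
  refine ⟨⟨?_, hdigit ▸ hpoints, hpoints⟩, ?_, htree ▸ hsets, hsets⟩
  · rw [cauchySet_eq_univ hX.metric.dense, coindSet_eq_univ hX.digitSpace.cover]
  · rw [cauchyCompacts_eq_univ hX.metric.dense, eq_comm]
    refine eq_univ_of_forall fun A => ?_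
    -- Membership comes from the translation itself: a Hausdorff name exists, and the tree obtained
    -- from it is a coinductive realizer.
    obtain ⟨p, hp⟩ := exists_hausdorffName hX.metric.dense A
    obtain ⟨Φ, -, hΦ⟩ := hsets.1
    obtain ⟨T, hT, -⟩ := hΦ p A hp
    exact mem_coindCompacts_of_coindTreeName (htree ▸ hT)
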